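/- Let $\Lambda$ be an $ADE$ Dynkin diagram (type $A_n$ with $n\ge 1$, $D_n$ with $n\ge 4$, $E_6$, $E_7$ or $E_8$) with a bipartition $\epsilon:\mathrm{Vert}(\Lambda)\to\{0,1\}$ (white: $\epsilon_v=0$, black: $\epsilon_v=1$), and let $h$ be its Coxeter number ($n+1$, $2n-2$, $12$, $18$, $30$, respectively). The twist $\Lambda\times\Lambda$ has two vertices $v_1,v_2$ for each node $v$ of $\Lambda$, with $\epsilon_{v_1}=\epsilon_{v_2}=\epsilon_v$; each edge $u - w$ of $\Lambda$ gives the red edges $u_1 - w_1$, $u_2 - w_2$ and the blue edges $u_1 - w_2$, $u_2 - w_1$. The quiver $Q_\Lambda$ is obtained by directing red edges from white to black and blue edges from black to white vertices. The $T$-system of $Q_\Lambda$ is the family $T_a(t)$ ($a\in\mathrm{Vert}(Q_\Lambda)$, $t\in\mathbb Z$, $t+\epsilon_a$ even) with $$T_a(t+1)\,T_a(t-1)=\prod_{b\to a}T_b(t)+\prod_{a\to b}T_b(t),\qquad T_a(\epsilon_a)=x_a,$$ in the field $\mathbb Q(\mathbf x)$ of rational functions. For $\lambda:\mathrm{Vert}(Q_\Lambda)\to\mathbb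 R$ the tropical $T$-system is the family $\mathfrak t^\lambda_a(t)\in\mathbb R$ with $$\mathfrak t^\lambda_a(t+1)+\mathfrak t^\lambda_a(t-1)=\max\Big(\sum_{b\to a}\mathfrak t^\lambda_b(t),\ \sum_{a\to b}\mathfrak t^\lambda_b(t)\Big),\qquad \mathfrak t^\lambda_a(\epsilon_a)=\lambda(a).$$ A labeled quiver $(Q,\rho)$ is a quiver with positive real labels on its vertices. Let $\widetilde\mu_a$ be the operation that mutates $Q$ at $a$ and replaces $\rho(a)$ by $\rho(a)^{-1}\big(\prod_{b\to a}\rho(b)+\prod_{a\to b}\rho(b)\big)$; let $\widetilde\mu_\circ,\widetilde\mu_\bullet$ be the products of the $\widetilde\mu_a$ over all white, respectively black, vertices. For a node $v$ of $\Lambda$ let $s_v$ be the operation that interchanges $v_1$ and $v_2$ (in the quiver and in the labeling), $\bar\mu_v=s_v\circ\widetilde\mu_{v_1}\circ\widetilde\mu_{v_2}$, and $S=\prod_{v}s_v$. Then: 1. The $T$-system and, for every $\lambda$, the tropical $T$-system of $Q_\Lambda$ exist and are periodic: $T_a(t+4h)=T_a(t)$ and $\mathfrak t^\lambda_a(t+4h)=\mathfrak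 t^\lambda_a(t)$ whenever $t+\epsilon_a$ is even. 2. For positive real initial values $\rho$, let $T_a(t)$ be the values of the $T$-system with $x_a=\rho(a)$. For all $k\ge0$, the labeling of $(\widetilde\mu_\bullet\circ\widetilde\mu_\circ)^k(Q_\Lambda,\rho)$ is $a\mapsto T_a(\epsilon_a+2k)$, and that of $(\widetilde\mu_\circ\circ\widetilde\mu_\bullet)^k(Q_\Lambda,\rho)$ is $a\mapsto T_a(\epsilon_a-2k)$. 3. The operations $\bar\mu_v$ preserve the quiver $Q_\Lambda$ and define an action of the Coxeter group of $\Lambda$ on the set of labeled quivers $(Q_\Lambda,\rho)$, in which the simple reflection at $v$ acts as $\bar\mu_v$. Let $E$ be $\widetilde\mu_\circ\circ\widetilde\mu_\bullet$ and $\bar\mu_\Lambda=\prod_{\epsilon_v=0}\bar\mu_v\circ\prod_{\epsilon_v=1}\bar\mu_v$, or let both be taken with the two colours interchanged. Then $\bar\mu_\Lambda$ is the action of a Coxeter element (the corresponding product of the simple reflections), and on the labeled quivers $(Q_\Lambda,\rho)$ $$E=S\circ\bar\mu_\Lambda=\bar\mu_\Lambda\circ S,\qquad \bar\mu_\Lambda^{\,h}=\mathrm{id},\qquad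 E^{2h}=\mathrm{id}.$$ If $h$ is even, then already $E^{h}=\mathrm{id}$; if $h$ is odd, then $E^{h}\neq\mathrm{id}$. -/

import Mathlib

/-! Bipartite quivers and bigraphs, quiver mutation, `T`-systems and their tropical versions,
twists `Λ × Λ` of `ADE` Dynkin diagrams and the operators acting on labeled quivers. -/

namespace ZamPer

/-! ### `ADE` Dynkin diagrams and Coxeter numbers -/

/-- The types of `ADE` Dynkin diagrams: `Aₙ` (`n ≥ 1`), `Dₙ` (`n ≥ 4`), `E₆`, `E₇`, `E₈`. -/
inductive DynkinType : Type
  | A (n : ℕ) (hn : 1 ≤ n)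
  | D (n : ℕ) (hn : 4 ≤ n)
  | E6
  | E7
  | E8

namespace DynkinType

/-- The number of nodes. -/
def rank : DynkinType → ℕ
  | A n _ => n
  | D n _ => n
  | E6 => 6
  | E7 => 7
  | E8 => 8

/-- The Coxeter number. -/
def coxeterNumber : DynkinType → ℕ
  | A n _ => n + 1
  | D n _ => 2 * n - 2
  | E6 => 12
  | E7 => 18
  | E8 => 30

/-- The edges `i - j` of the diagram, each written in one direction.
Type `A` is the path `0 - 1 - ⋯ - (n-1)`.  In the types `D` and `E` the nodes `0, …, n-2` form a
path, and the last node `n-1` is attached to the node `n-3` in type `D` and to the node `2` in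
type `E`. -/
def edge : DynkinType → ℕ → ℕ → Prop
  | A _ _, i, j => i + 1 = j
  | D n _, i, j => (i + 1 = j ∧ j + 1 < n) ∨ (i + 3 = n ∧ j + 1 = n)
  | E6, i, j => (i + 1 = j ∧ j < 5) ∨ (i = 2 ∧ j = 5)
  | E7, i, j => (i + 1 = j ∧ j < 6) ∨ (i = 2 ∧ j = 6)
  | E8, i, j => (i + 1 = j ∧ j < 7) ∨ (i = 2 ∧ j = 7)

/-- The Dynkin diagram of the given type. -/
def graph (X : DynkinType) : SimpleGraph (Fin X.rank) :=
  SimpleGraph.fromRel fun i j => X.edge i j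

end DynkinType

open Classical in
/-- The Coxeter matrix of a simply-laced diagram: `m(u,w) = 3` if `u` and `w` are adjacent and
`m(u,w) = 2` if `u ≠ w` are not adjacent. -/
noncomputable def coxeterMatrix {V : Type*} (Λ : SimpleGraph V) : CoxeterMatrix V where
  M := Matrix.of fun u w => if u = w then 1 else if Λ.Adj u w then 3 else 2
  isSymm := by
    ext u w
    simp only [Matrix.transpose_apply, Matrix.of_apply, eq_comm (a := w), Λ.adj_comm w]
  diagonal u := by simp
  off_diagonal u w h := by
    simp only [Matrix.of_apply, if_neg h]
    split_ifs <;> decide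

/-! ### Quivers, bigraphs, bipartitions -/

/-- A quiver without loops and directed `2`-cycles: `arrows u w` is the number of arrows `u → w`.
(For `u = w` the condition says that there are no loops.) -/
@[ext]
structure ClusterQuiver (V : Type*) where
  arrows : V → V → ℕ
  no_two_cycle : ∀ u w, arrows u w = 0 ∨ arrows w u = 0

/-- A bigraph: two simple graphs (red `Γ`, blue `Δ`) on the same vertices without common edges. -/
structure Bigraph (V : Type*) where
  Γ : SimpleGraph V
  Δ : SimpleGraph V
  not_both : ∀ u w, ¬ (Γ.Adj u w ∧ Δ.Adj u w)

open Classical in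
/-- The quiver `Q(G)` of a bigraph `G` with bipartition `ε` (white: `ε = 0`, black: `ε = 1`):
red edges are directed from white to black and blue edges from black to white. -/
noncomputable def Bigraph.toQuiver {V : Type*} (G : Bigraph V) (ε : V → Fin 2) :
    ClusterQuiver V where
  arrows u w :=
    if (G.Γ.Adj u w ∧ ε u = 0 ∧ ε w = 1) ∨ (G.Δ.Adj u w ∧ ε u = 1 ∧ ε w = 0) then 1 else 0
  no_two_cycle u w := by
    have h := G.not_both u w
    rw [G.Γ.adj_comm w u, G.Δ.adj_comm w u]
    have h01 : (0 : Fin 2) ≠ 1 := by decide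
    grind

/-- The twist `Λ × Λ`: the nodes `v₁, v₂` over a node `v` of `Λ` are `(v, 0), (v, 1)`; an edge
`u - w` of `Λ` gives the red edges `u₁ - w₁`, `u₂ - w₂` and the blue edges `u₁ - w₂`,
`u₂ - w₁`. -/
def twist {V : Type*} (Λ : SimpleGraph V) : Bigraph (V × Fin 2) where
  Γ :=
    { Adj := fun a b => Λ.Adj a.1 b.1 ∧ a.2 = b.2
      symm := ⟨fun _ _ h => ⟨h.1.symm, h.2.symm⟩⟩
      loopless := ⟨fun _ h => Λ.irrefl h.1⟩ }
  Δ :=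
    { Adj := fun a b => Λ.Adj a.1 b.1 ∧ a.2 ≠ b.2
      symm := ⟨fun _ _ h => ⟨h.1.symm, h.2.symm⟩⟩
      loopless := ⟨fun _ h => Λ.irrefl h.1⟩ }
  not_both _ _ h := h.2.2 h.1.2

/-- The bipartition of `Λ × Λ` induced by a bipartition of `Λ`. -/
def twistColor {V : Type*} (ε : V → Fin 2) : V × Fin 2 → Fin 2 := fun a => ε a.1

/-- The quiver `Q_Λ = Q(Λ × Λ)`. -/
noncomputable def twistQuiver {V : Type*} (Λ : SimpleGraph V) (ε : V → Fin 2) :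
    ClusterQuiver (V × Fin 2) :=
  (twist Λ).toQuiver (twistColor ε)

/-! ### `T`-systems -/

/-- `T` is a solution of the `T`-system of `(Q, ε)` with initial values `x`:
`T_v(t+1) T_v(t-1) = ∏_{u → v} T_u(t) + ∏_{v → w} T_w(t)` and `T_v(ε_v) = x_v`.  Only the values
`T_v(t)` with `t + ε_v` even are constrained. -/
def IsTSystem {V K : Type*} [Fintype V] [CommSemiring K] (Q : ClusterQuiver V) (ε : V → Fin 2)
    (x : V → K) (T : V → ℤ → K) : Prop :=
  (∀ v, T v ((ε v : ℕ) : ℤ) = x v) ∧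
  ∀ v t, Even (t + 1 + ((ε v : ℕ) : ℤ)) →
    T v (t + 1) * T v (t - 1) =
      (∏ u, T u t ^ Q.arrows u v) + ∏ w, T w t ^ Q.arrows v w

/-- `τ` is the tropical `T`-system of `(Q, ε)` with initial values `l`. -/
def IsTropicalTSystem {V : Type*} [Fintype V] (Q : ClusterQuiver V) (ε : V → Fin 2)
    (l : V → ℝ) (τ : V → ℤ → ℝ) : Prop :=
  (∀ v, τ v ((ε v : ℕ) : ℤ) = l v) ∧
  ∀ v t, Even (t + 1 + ((ε v : ℕ) : ℤ)) →
    τ v (t + 1) + τ v (t - 1) =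
      max (∑ u, (Q.arrows u v : ℝ) * τ u t) (∑ w, (Q.arrows v w : ℝ) * τ w t)

/-- `f` is periodic with the (positive) parameter `N`: `f_v(t + 2N) = f_v(t)` whenever `t + ε_v`
is even. -/
def IsPeriodicWith {V K : Type*} (ε : V → Fin 2) (f : V → ℤ → K) (N : ℕ) : Prop :=
  0 < N ∧ ∀ v t, Even (t + ((ε v : ℕ) : ℤ)) → f v (t + 2 * (N : ℤ)) = f v t

/-- The field `ℚ(x)` of rational functions in indeterminates `x_v`. -/
abbrev RatFun (V : Type*) : Type _ := FractionRing (MvPolynomial V ℚ)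

/-- The indeterminate `x_v` as an element of `ℚ(x)`. -/
noncomputable def RatFun.x {V : Type*} (v : V) : RatFun V :=
  algebraMap (MvPolynomial V ℚ) (RatFun V) (MvPolynomial.X v)

/-! ### Labeled quivers and mutations -/

/-- Quiver mutation at `v`: add `u → w` for each pair `u → v → w`, reverse the arrows at `v`,
cancel directed `2`-cycles. -/
def ClusterQuiver.mutate {V : Type*} [DecidableEq V] (Q : ClusterQuiver V) (v : V) :
    ClusterQuiver V where
  arrows u w :=
    if u = v ∨ w = v then Q.arrows w u
    else (Q.arrows u w + Q.arrows u v * Q.arrows v w)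
      - (Q.arrows w u + Q.arrows w v * Q.arrows v u)
  no_two_cycle u w := by
    have h := Q.no_two_cycle u w
    by_cases h1 : u = v ∨ w = v
    · have h2 : w = v ∨ u = v := h1.symm
      simp only [if_pos h1, if_pos h2]
      exact h.symm
    · have h2 : ¬ (w = v ∨ u = v) := fun h => h1 h.symm
      simp only [if_neg h1, if_neg h2]
      omega

/-- The quiver obtained by renaming the vertices along a permutation `σ` with `σ⁻¹ = σ`. -/
def ClusterQuiver.relabel {V : Type*} (Q : ClusterQuiver V) (σ : Equiv.Perm V) :
    ClusterQuiver V where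
  arrows u w := Q.arrows (σ u) (σ w)
  no_two_cycle u w := Q.no_two_cycle (σ u) (σ w)

/-- A labeled quiver `(Q, ρ)`: a quiver with a positive real label at each vertex. -/
@[ext]
structure LabeledQuiver (V : Type*) where
  quiver : ClusterQuiver V
  label : V → ℝ
  label_pos : ∀ v, 0 < label v

/-- The operation `μ̃_v` on labeled quivers: it mutates the quiver at `v` and replaces `ρ(v)` by
`ρ'(v)` with `ρ'(v) ρ(v) = ∏_{u → v} ρ(u) + ∏_{v → w} ρ(w)`. -/
noncomputable def LabeledQuiver.mutate {V : Type*} [Fintype V] [DecidableEq V] (v : V)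
    (q : LabeledQuiver V) : LabeledQuiver V where
  quiver := q.quiver.mutate v
  label := Function.update q.label v
    (((∏ u, q.label u ^ q.quiver.arrows u v) + ∏ w, q.label w ^ q.quiver.arrows v w) / q.label v)
  label_pos u := by
    have hp : ∀ e : V → ℕ, 0 < ∏ w, q.label w ^ e w :=
      fun e => Finset.prod_pos fun w _ => pow_pos (q.label_pos w) _
    by_cases h : u = v
    · subst h
      rw [Function.update_self]
      exact div_pos (add_pos (hp _) (hp _)) (q.label_pos u)
    · rw [Function.update_of_ne h]
      exact q.label_pos u

/-- The operation `s_v`, which swaps `v₁` and `v₂` in a labeled quiver on the vertices of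
`Λ × Λ`. -/
def LabeledQuiver.swap {V : Type*} [DecidableEq V] (v : V) (q : LabeledQuiver (V × Fin 2)) :
    LabeledQuiver (V × Fin 2) where
  quiver := q.quiver.relabel (Equiv.swap (v, 0) (v, 1))
  label := fun a => q.label (Equiv.swap (v, 0) (v, 1) a)
  label_pos _ := q.label_pos _

/-- The operation `μ̄_v = s_v ∘ μ̃_{v₁} ∘ μ̃_{v₂}`. -/
noncomputable def LabeledQuiver.barMutate {V : Type*} [Fintype V] [DecidableEq V] (v : V) :
    LabeledQuiver (V × Fin 2) → LabeledQuiver (V × Fin 2) :=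
  LabeledQuiver.swap v ∘ LabeledQuiver.mutate (v, 0) ∘ LabeledQuiver.mutate (v, 1)

/-! ### Products of operators -/

/-- The composition `f_{i₁} ∘ f_{i₂} ∘ ⋯ ∘ f_{iₖ}` of operators along a list. -/
def compList {ι X : Type*} (f : ι → X → X) : List ι → X → X
  | [] => id
  | i :: l => f i ∘ compList f l

/-- The vertices of colour `c`, listed in some order.  All products below run over operators that
commute where they are applied, so that the order does not matter. -/
noncomputable def colorList {V : Type*} [Fintype V] (ε : V → Fin 2) (c : Fin 2) : List V :=
  (Finset.univ.filter fun v => ε v = c).toList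

/-- `μ̃_∘` (for `c = 0`) and `μ̃_•` (for `c = 1`): the product of the `μ̃_v` over all vertices `v`
of colour `c`. -/
noncomputable def colorMutate {V : Type*} [Fintype V] [DecidableEq V] (ε : V → Fin 2) (c : Fin 2) :
    LabeledQuiver V → LabeledQuiver V :=
  compList LabeledQuiver.mutate (colorList ε c)

/-- The time evolution that mutates first at the vertices of colour `c` and then at those of the
other colour: `μ̃_• ∘ μ̃_∘` for `c = 0` and `μ̃_∘ ∘ μ̃_•` for `c = 1`. -/
noncomputable def evolution {V : Type*} [Fintype V] [DecidableEq V] (ε : V → Fin 2) (c : Fin 2) :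
    LabeledQuiver V → LabeledQuiver V :=
  colorMutate ε (1 - c) ∘ colorMutate ε c

/-- The vertex swap `∏_{v ∈ Λ} s_v`. -/
noncomputable def swapAll (V : Type*) [Fintype V] [DecidableEq V] :
    LabeledQuiver (V × Fin 2) → LabeledQuiver (V × Fin 2) :=
  compList LabeledQuiver.swap (Finset.univ : Finset V).toList

/-- The operator `μ̄_Λ`: the product of the `μ̄_v` over the nodes of `Λ` of colour `1 - c`, composed
with the product over the nodes of colour `c` (which is applied first). -/
noncomputable def barMutateAll {V : Type*} [Fintype V] [DecidableEq V] (ε : V → Fin 2)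
    (c : Fin 2) : LabeledQuiver (V × Fin 2) → LabeledQuiver (V × Fin 2) :=
  compList LabeledQuiver.barMutate (colorList ε (1 - c)) ∘
    compList LabeledQuiver.barMutate (colorList ε c)

/-- The bipartite Coxeter element of the Coxeter group of `Λ`: the product of the simple
reflections of colour `1 - c` times the product of those of colour `c`. -/
noncomputable def coxeterElement {V : Type*} [Fintype V] (Λ : SimpleGraph V) (ε : V → Fin 2)
    (c : Fin 2) : (coxeterMatrix Λ).Group :=
  ((colorList ε (1 - c)).map (coxeterMatrix Λ).simple).prod *
    ((colorList ε c).map (coxeterMatrix Λ).simple).prod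

/-- The labeled quivers `(Q_Λ, ρ)` whose quiver is `Q_Λ`. -/
def TwistLabeling {V : Type*} (Λ : SimpleGraph V) (ε : V → Fin 2) : Type _ :=
  {q : LabeledQuiver (V × Fin 2) // q.quiver = twistQuiver Λ ε}

end ZamPer

open ZamPer

namespace ZamPer

open Finset

/-! ### Linear recurrences on Dynkin diagrams -/

open Classical in
/-- The neighbours of `v`. -/
noncomputable def nbrs {V : Type*} [Fintype V] (Λ : SimpleGraph V) (v : V) : Finset V :=
  univ.filter fun u => Λ.Adj u v

@[simp]
theorem mem_nbrs {V : Type*} [Fintype V] {Λ : SimpleGraph V} {u v : V} :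
    u ∈ nbrs Λ v ↔ Λ.Adj u v := by
  simp [nbrs]

/-- The homogeneous linear recurrence of a graph. -/
def IsHarmonic {V : Type*} [Fintype V] (Λ : SimpleGraph V) (z : V → ℤ → ℤ) : Prop :=
  ∀ v t, z v (t + 1) + z v (t - 1) = ∑ u ∈ nbrs Λ v, z u t

theorem IsHarmonic.comp_iso {V W : Type*} [Fintype V] [Fintype W] {Λ : SimpleGraph V}
    {M : SimpleGraph W} {z : V → ℤ → ℤ} (hz : IsHarmonic Λ z) (e : Λ ≃g M) :
    IsHarmonic M fun w => z (e.symm w) := by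
  intro w t
  rw [hz]
  refine sum_bij (fun u _ => e u) ?_ ?_ ?_ ?_
  · intro u hu
    rw [mem_nbrs] at hu ⊢
    simpa using e.map_adj_iff.2 hu
  · intro a _ b _ h
    exact e.injective h
  · intro b hb
    rw [mem_nbrs] at hb
    exact ⟨e.symm b, mem_nbrs.2 (e.symm.map_adj_iff.2 hb), by simp⟩
  · intro u _
    simp

section Chain

variable {y : ℕ → ℤ → ℤ} {m : ℕ}

theorem chain_right (h1 : ∀ t, y 1 t = y 0 (t + 1) + y 0 (t - 1))
    (h2 : ∀ i, i + 2 ≤ m → ∀ t, y (i + 1) (t + 1) + y (i + 1) (t - 1) = y i t + y (i + 2) t)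
    (i : ℕ) (hi : i + 1 ≤ m) (t : ℤ) : y (i + 1) t = y i (t - 1) + y 0 (t + (i + 1)) := by
  induction i generalizing t with
  | zero => rw [h1]; simp [add_comm]
  | succ i ih =>
    have a := h2 i hi t
    rw [ih (by omega) (t + 1)] at a
    rw [show t + 1 - 1 = t by ring, show t + 1 + ((i : ℤ) + 1) = t + (i + 1 + 1) by ring] at a
    push_cast
    linarith

theorem chain_left (h1 : ∀ t, y 1 t = y 0 (t + 1) + y 0 (t - 1))
    (h2 : ∀ i, i + 2 ≤ m → ∀ t, y (i + 1) (t + 1) + y (i + 1) (t - 1) = y i t + y (i + 2) t)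
    (i : ℕ) (hi : i + 1 ≤ m) (t : ℤ) : y (i + 1) t = y i (t + 1) + y 0 (t - (i + 1)) := by
  induction i generalizing t with
  | zero => rw [h1]; simp
  | succ i ih =>
    have a := h2 i hi t
    rw [ih (by omega) (t - 1)] at a
    rw [show t - 1 + 1 = t by ring, show t - 1 - ((i : ℤ) + 1) = t - (i + 1 + 1) by ring] at a
    push_cast
    linarith

theorem chain_periodic (h1 : ∀ t, y 1 t = y 0 (t + 1) + y 0 (t - 1))
    (h2 : ∀ i, i + 2 ≤ m → ∀ t, y (i + 1) (t + 1) + y (i + 1) (t - 1) = y i t + y (i + 2) t)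
    {p : ℤ} (hp : ∀ t, y 0 (t + p) = y 0 t) (i : ℕ) (hi : i ≤ m) (t : ℤ) :
    y i (t + p) = y i t := by
  induction i generalizing t with
  | zero => exact hp t
  | succ i ih =>
    rw [chain_right h1 h2 i hi, chain_right h1 h2 i hi t, ← ih (by omega) (t - 1),
      ← hp (t + (i + 1))]
    congr 2 <;> ring

end Chain

theorem IsHarmonic.periodic_A {n : ℕ} (hn : 1 ≤ n) {Λ : SimpleGraph (Fin n)}
    (hΛ : ∀ i j : Fin n, Λ.Adj i j ↔ i.1 + 1 = j ∨ j.1 + 1 = i) {z : Fin n → ℤ → ℤ}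
    (hz : IsHarmonic Λ z) (v : Fin n) (t : ℤ) :
    z v (t + 2 * (n + 1)) = z v t := by
  obtain ⟨y, hy⟩ : ∃ y : ℕ → ℤ → ℤ, y = fun i t => if h : i < n then z ⟨i, h⟩ t else 0 := ⟨_, rfl⟩
  have hsum : ∀ i (hi : i < n) (t : ℤ), ∑ u ∈ nbrs Λ ⟨i, hi⟩, z u t =
      (if 0 < i then y (i - 1) t else 0) + y (i + 1) t := by
    intro i hi t
    have e1 : ∑ u ∈ nbrs Λ ⟨i, hi⟩, z u t =
        ∑ k ∈ range n, if k + 1 = i ∨ i + 1 = k then y k t else 0 := by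
      rw [← Fin.sum_univ_eq_sum_range (fun k => if k + 1 = i ∨ i + 1 = k then y k t else 0),
        ← sum_filter]
      refine sum_congr ?_ fun u _ => ?_
      · ext u
        simp only [mem_nbrs, mem_filter, hΛ, mem_univ, true_and]
      · simp [hy]
    have e2 : ∀ k, (if k + 1 = i ∨ i + 1 = k then y k t else 0) =
        (if i + 1 = k then y k t else 0) + if i - 1 = k then (if 0 < i then y k t else 0) else 0 := by
      intro k
      split_ifs <;> omega
    rw [e1, sum_congr rfl fun k _ => e2 k, sum_add_distrib, sum_ite_eq, sum_ite_eq,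
      if_pos (show i - 1 ∈ range n by simp; omega), add_comm]
    congr 1
    split_ifs with h
    · rfl
    · rw [mem_range] at h
      simp [hy, h]
  have hrec : ∀ i (hi : i < n) (t : ℤ), y i (t + 1) + y i (t - 1) =
      (if 0 < i then y (i - 1) t else 0) + y (i + 1) t := by
    intro i hi t
    rw [← hsum i hi t, ← hz ⟨i, hi⟩ t]
    simp only [hy, dif_pos hi]
  have h1 : ∀ t, y 1 t = y 0 (t + 1) + y 0 (t - 1) := fun t => by
    rw [hrec 0 (by omega)]; simp
  have h2 : ∀ i, i + 2 ≤ n → ∀ t,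
      y (i + 1) (t + 1) + y (i + 1) (t - 1) = y i t + y (i + 2) t := fun i hi t => by
    rw [hrec (i + 1) (by omega)]; simp
  have h0 : ∀ t, y n t = 0 := fun t => by simp [hy]
  obtain ⟨k, rfl⟩ : ∃ k, n = k + 1 := ⟨n - 1, by omega⟩
  have hp : ∀ t, y 0 (t + 2 * ((k + 1 : ℕ) + 1)) = y 0 t := by
    intro t
    have a := chain_right h1 h2 k le_rfl (t + (k + 1) + 2)
    have b := chain_left h1 h2 k le_rfl (t + (k + 1))
    rw [h0] at a b
    rw [show t + (k + 1) + 2 - 1 = t + (k + 1) + 1 by ring] at a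
    rw [show t + ((k : ℤ) + 1) - (k + 1) = t by ring] at b
    rw [show t + 2 * (((k + 1 : ℕ) : ℤ) + 1) = t + (k + 1) + 2 + (k + 1) by push_cast; ring]
    linarith
  have := chain_periodic h1 h2 hp v.1 v.2.le t
  simpa only [hy, dif_pos v.2] using this

theorem IsHarmonic.periodic_D {n : ℕ} (hn : 4 ≤ n) {Λ : SimpleGraph (Fin n)}
    (hΛ : ∀ i j : Fin n, Λ.Adj i j ↔ (i.1 + 1 = j ∧ j.1 + 1 < n) ∨ (j.1 + 1 = i ∧ i.1 + 1 < n) ∨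
      (i.1 + 3 = n ∧ j.1 + 1 = n) ∨ (j.1 + 3 = n ∧ i.1 + 1 = n)) {z : Fin n → ℤ → ℤ}
    (hz : IsHarmonic Λ z) (v : Fin n) (t : ℤ) :
    z v (t + 4 * (n - 1)) = z v t := by
  obtain ⟨m, rfl⟩ : ∃ m, n = m + 4 := ⟨n - 4, by omega⟩
  have hN0 : nbrs Λ (⟨0, by omega⟩ : Fin (m + 4)) =
      {(⟨1, by omega⟩ : Fin (m + 4))} := by
    ext u
    simp only [mem_nbrs, hΛ, Fin.ext_iff, mem_singleton]
    omega
  have hN1 : ∀ i (hi : i < m), nbrs Λ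
      (⟨i + 1, by omega⟩ : Fin (m + 4)) =
      {(⟨i, by omega⟩ : Fin (m + 4)), (⟨i + 2, by omega⟩ : Fin (m + 4))} := by
    intro i hi
    ext u
    simp only [mem_nbrs, hΛ, Fin.ext_iff, mem_singleton, mem_insert]
    omega
  have hN2 : nbrs Λ (⟨m + 1, by omega⟩ : Fin (m + 4)) =
      {(⟨m, by omega⟩ : Fin (m + 4)), (⟨m + 2, by omega⟩ : Fin (m + 4)),
        (⟨m + 3, by omega⟩ : Fin (m + 4))} := by
    ext u
    simp only [mem_nbrs, hΛ, Fin.ext_iff, mem_singleton, mem_insert, true_and]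
    omega
  have hN3 : nbrs Λ (⟨m + 2, by omega⟩ : Fin (m + 4)) =
      {(⟨m + 1, by omega⟩ : Fin (m + 4))} := by
    ext u
    simp only [mem_nbrs, hΛ, Fin.ext_iff, mem_singleton]
    omega
  have hN4 : nbrs Λ (⟨m + 3, by omega⟩ : Fin (m + 4)) =
      {(⟨m + 1, by omega⟩ : Fin (m + 4))} := by
    ext u
    simp only [mem_nbrs, hΛ, Fin.ext_iff, mem_singleton, and_true]
    omega
  have r0 : ∀ t, z ⟨0, by omega⟩ (t + 1) + z ⟨0, by omega⟩ (t - 1) = z ⟨1, by omega⟩ t :=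
    fun t => (hz _ t).trans (by rw [hN0, sum_singleton])
  have r1 : ∀ i (hi : i < m) t, z ⟨i + 1, by omega⟩ (t + 1) + z ⟨i + 1, by omega⟩ (t - 1) =
      z ⟨i, by omega⟩ t + z ⟨i + 2, by omega⟩ t :=
    fun i hi t => (hz _ t).trans (by rw [hN1 i hi, sum_pair (by simp [Fin.ext_iff])])
  have r2 : ∀ t, z ⟨m + 1, by omega⟩ (t + 1) + z ⟨m + 1, by omega⟩ (t - 1) =
      z ⟨m, by omega⟩ t + (z ⟨m + 2, by omega⟩ t + z ⟨m + 3, by omega⟩ t) :=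
    fun t => (hz _ t).trans (by
      rw [hN2, sum_insert (by simp [Fin.ext_iff]), sum_pair (by simp [Fin.ext_iff])])
  have r3 : ∀ t, z ⟨m + 2, by omega⟩ (t + 1) + z ⟨m + 2, by omega⟩ (t - 1) =
      z ⟨m + 1, by omega⟩ t :=
    fun t => (hz _ t).trans (by rw [hN3, sum_singleton])
  have r4 : ∀ t, z ⟨m + 3, by omega⟩ (t + 1) + z ⟨m + 3, by omega⟩ (t - 1) =
      z ⟨m + 1, by omega⟩ t :=
    fun t => (hz _ t).trans (by rw [hN4, sum_singleton])
  obtain ⟨y, hy⟩ : ∃ y : ℕ → ℤ → ℤ, y = fun i t =>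
      if h : i ≤ m + 1 then z ⟨i, by omega⟩ t else
        if i = m + 2 then z ⟨m + 2, by omega⟩ t + z ⟨m + 3, by omega⟩ t else
          z ⟨m + 1, by omega⟩ t := ⟨_, rfl⟩
  have y0 : ∀ i (h : i ≤ m + 1) t, y i t = z ⟨i, by omega⟩ t := fun i h t => by simp [hy, h]
  have y2 : ∀ t, y (m + 2) t = z ⟨m + 2, by omega⟩ t + z ⟨m + 3, by omega⟩ t :=
    fun t => by simp [hy]
  have y3 : ∀ t, y (m + 3) t = z ⟨m + 1, by omega⟩ t := fun t => by simp [hy]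
  have h1 : ∀ t, y 1 t = y 0 (t + 1) + y 0 (t - 1) := fun t => by
    rw [y0 0 (by omega), y0 0 (by omega), y0 1 (by omega), r0]
  have h2 : ∀ i, i + 2 ≤ m + 3 → ∀ t,
      y (i + 1) (t + 1) + y (i + 1) (t - 1) = y i t + y (i + 2) t := fun i hi t => by
    rcases lt_trichotomy i m with h | rfl | h
    · rw [y0 _ (by omega), y0 _ (by omega), y0 _ (by omega), y0 _ (by omega), r1 i h]
    · rw [y0 _ (by omega), y0 _ (by omega), y0 _ (by omega), y2, r2]
    · obtain rfl : i = m + 1 := by omega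
      rw [y2, y2, y3, y0 _ (by omega)]
      linarith [r3 t, r4 t]
  have hanti : ∀ t, y 0 (t + 2 * (m + 3)) = - y 0 t := by
    intro t
    have a := chain_right h1 h2 (m + 2) le_rfl (t + (m + 3))
    have b := chain_left h1 h2 (m + 1) (by omega) (t + (m + 3) - 1)
    rw [y3, ← y0 (m + 1) le_rfl] at a
    rw [show t + ((m : ℤ) + 3) - 1 + 1 = t + (m + 3) by ring,
      show t + ((m : ℤ) + 3) - 1 - ((m + 1 : ℕ) + 1) = t by push_cast; ring] at b
    rw [show t + ((m : ℤ) + 3) + ((m + 2 : ℕ) + 1) = t + 2 * (m + 3) by push_cast; ring] at a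
    linarith
  have hP : ((m + 4 : ℕ) : ℤ) - 1 = m + 3 := by push_cast; ring
  rw [hP]
  have hp : ∀ t, y 0 (t + 4 * (m + 3)) = y 0 t := by
    intro t
    rw [show t + 4 * ((m : ℤ) + 3) = t + 2 * (m + 3) + 2 * (m + 3) by ring, hanti, hanti, neg_neg]
  have hyp := fun i hi => chain_periodic (m := m + 3) h1 h2 hp i hi
  have hd : ∀ (k : ℕ) (t : ℤ), z ⟨m + 2, by omega⟩ (t + 4 * k) - z ⟨m + 3, by omega⟩ (t + 4 * k) =
      z ⟨m + 2, by omega⟩ t - z ⟨m + 3, by omega⟩ t := by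
    intro k
    induction k with
    | zero => simp
    | succ k ih =>
      intro t
      have e1 := r3 (t + 4 * k + 1)
      have e2 := r4 (t + 4 * k + 1)
      have e3 := r3 (t + 4 * k + 3)
      have e4 := r4 (t + 4 * k + 3)
      rw [show t + 4 * (k : ℤ) + 1 - 1 = t + 4 * k by ring,
        show t + 4 * (k : ℤ) + 1 + 1 = t + 4 * k + 2 by ring] at e1 e2
      rw [show t + 4 * (k : ℤ) + 3 - 1 = t + 4 * k + 2 by ring,
        show t + 4 * (k : ℤ) + 3 + 1 = t + 4 * (k + 1 : ℕ) by push_cast; ring] at e3 e4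
      linarith [ih t]
  have hd' := hd (m + 3) t
  push_cast at hd'
  have hs := hyp (m + 2) (by omega) t
  rw [y2, y2] at hs
  obtain ⟨i, hi⟩ := v
  by_cases h : i ≤ m + 1
  · rw [← y0 i h, ← y0 i h]
    exact hyp i (by omega) t
  · obtain rfl | rfl : i = m + 2 ∨ i = m + 3 := by omega
    · linarith
    · linarith

theorem harmonic_arm {f0 f1 f2 f3 f4 b w : ℤ → ℤ} (hw : ∀ t, w t = f1 t - b t)
    (r0 : ∀ t, f0 (t + 1) + f0 (t - 1) = f1 t)
    (r1 : ∀ t, f1 (t + 1) + f1 (t - 1) = f0 t + f2 t)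
    (r2 : ∀ t, f2 (t + 1) + f2 (t - 1) = f1 t + (f3 t + b t))
    (r3 : ∀ t, f3 (t + 1) + f3 (t - 1) = f2 t + f4 t)
    (rb : ∀ t, b (t + 1) + b (t - 1) = f2 t) :
    (∀ t, f0 t = w (t + 1) + w (t - 1)) ∧
    (∀ t, f1 t = w (t + 2) + 2 * w t + w (t - 2)) ∧
    (∀ t, b t = w (t + 2) + w t + w (t - 2)) ∧
    (∀ t, f2 t = w (t + 3) + 2 * w (t + 1) + 2 * w (t - 1) + w (t - 3)) ∧
    (∀ t, f3 t = w (t + 4) + w (t + 2) + w t + w (t - 2) + w (t - 4)) ∧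
    (∀ t, f4 t = w (t + 5) + w (t + 3) + w (t - 3) + w (t - 5)) := by
  have e0 : ∀ t, f0 t = w (t + 1) + w (t - 1) := fun t => by
    linarith [hw (t + 1), hw (t - 1), r1 t, rb t]
  have e1 : ∀ t, f1 t = w (t + 2) + 2 * w t + w (t - 2) := fun t => by
    have h1 := r0 t
    rw [e0, e0] at h1
    ring_nf at h1 ⊢
    linarith
  have eb : ∀ t, b t = w (t + 2) + w t + w (t - 2) := fun t => by
    linarith [hw t, e1 t]
  have e2 : ∀ t, f2 t = w (t + 3) + 2 * w (t + 1) + 2 * w (t - 1) + w (t - 3) := fun t => by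
    have h1 := rb t
    rw [eb, eb] at h1
    ring_nf at h1 ⊢
    linarith
  have e3 : ∀ t, f3 t = w (t + 4) + w (t + 2) + w t + w (t - 2) + w (t - 4) := fun t => by
    have h1 := r2 t
    rw [e2, e2, e1, eb] at h1
    ring_nf at h1 ⊢
    linarith
  refine ⟨e0, e1, eb, e2, e3, fun t => ?_⟩
  have h1 := r3 t
  rw [e3, e3, e2] at h1
  ring_nf at h1 ⊢
  linarith

theorem IsHarmonic.periodic_E6 {Λ : SimpleGraph (Fin 6)}
    (hΛ : ∀ i j : Fin 6, Λ.Adj i j ↔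
      s(i, j) ∈ ({s(0, 1), s(1, 2), s(2, 3), s(3, 4), s(2, 5)} :
        Finset (Sym2 (Fin 6))))
    {z : Fin 6 → ℤ → ℤ} (hz : IsHarmonic Λ z) (v : Fin 6) (t : ℤ) :
    z v (t + 24) = z v t := by
  have hN : nbrs Λ = ![{1}, {0, 2}, {1, 3, 5}, {2, 4}, {3}, {2}] := by
    funext v
    ext u
    rw [mem_nbrs, hΛ]
    revert u v
    decide
  have r0 : ∀ t, z 0 (t + 1) + z 0 (t - 1) = z 1 t := fun t => by
    rw [hz, hN]; simp
  have r1 : ∀ t, z 1 (t + 1) + z 1 (t - 1) = z 0 t + z 2 t := fun t => by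
    rw [hz, hN]; simp
  have r2 : ∀ t, z 2 (t + 1) + z 2 (t - 1) = z 1 t + (z 3 t + z 5 t) := fun t => by
    rw [hz, hN]; simp
  have r3 : ∀ t, z 3 (t + 1) + z 3 (t - 1) = z 2 t + z 4 t := fun t => by
    rw [hz, hN]; simp
  have r4 : ∀ t, z 4 (t + 1) + z 4 (t - 1) = z 3 t := fun t => by
    rw [hz, hN]; simp
  have r5 : ∀ t, z 5 (t + 1) + z 5 (t - 1) = z 2 t := fun t => by
    rw [hz, hN]; simp
  obtain ⟨w, hw⟩ : ∃ w : ℤ → ℤ, ∀ t, w t = z 1 t - z 5 t := ⟨_, fun _ => rfl⟩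
  obtain ⟨e0, e1, e5, e2, e3, e4⟩ := harmonic_arm hw r0 r1 r2 r3 r5
  have hrec : ∀ t, w (t + 12) + w (t + 10) - w (t + 6) + w (t + 2) + w t = 0 := fun t => by
    have h1 := r4 (t + 6)
    rw [e4, e4, e3] at h1
    ring_nf at h1 ⊢
    linarith
  have hp : ∀ t, w (t + 24) = w t := fun t => by
    have p0 := hrec t
    have p1 := hrec (t + 2)
    have p2 := hrec (t + 4)
    have p4 := hrec (t + 8)
    have p5 := hrec (t + 10)
    have p6 := hrec (t + 12)
    ring_nf at p0 p1 p2 p4 p5 p6 ⊢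
    linear_combination -p0 + p1 - p2 + p4 - p5 + p6
  have hadd : ∀ a, w (t + 24 + a) = w (t + a) := fun a => by
    rw [add_right_comm, hp]
  have hsub : ∀ a, w (t + 24 - a) = w (t - a) := fun a => by
    rw [add_sub_right_comm, hp]
  fin_cases v
  · exact (by rw [e0, e0]; simp only [hadd, hsub] : z 0 (t + 24) = z 0 t)
  · exact (by rw [e1, e1]; simp only [hadd, hsub, hp] : z 1 (t + 24) = z 1 t)
  · exact (by rw [e2, e2]; simp only [hadd, hsub] : z 2 (t + 24) = z 2 t)
  · exact (by rw [e3, e3]; simp only [hadd, hsub, hp] : z 3 (t + 24) = z 3 t)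
  · exact (by rw [e4, e4]; simp only [hadd, hsub] : z 4 (t + 24) = z 4 t)
  · exact (by rw [e5, e5]; simp only [hadd, hsub, hp] : z 5 (t + 24) = z 5 t)

theorem IsHarmonic.periodic_E7 {Λ : SimpleGraph (Fin 7)}
    (hΛ : ∀ i j : Fin 7, Λ.Adj i j ↔
      s(i, j) ∈ ({s(0, 1), s(1, 2), s(2, 3), s(3, 4), s(4, 5), s(2, 6)} :
        Finset (Sym2 (Fin 7))))
    {z : Fin 7 → ℤ → ℤ} (hz : IsHarmonic Λ z) (v : Fin 7) (t : ℤ) :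
    z v (t + 36) = z v t := by
  have hN : nbrs Λ = ![{1}, {0, 2}, {1, 3, 6}, {2, 4}, {3, 5}, {4}, {2}] := by
    funext v
    ext u
    rw [mem_nbrs, hΛ]
    revert u v
    decide
  have r0 : ∀ t, z 0 (t + 1) + z 0 (t - 1) = z 1 t := fun t => by
    rw [hz, hN]; simp
  have r1 : ∀ t, z 1 (t + 1) + z 1 (t - 1) = z 0 t + z 2 t := fun t => by
    rw [hz, hN]; simp
  have r2 : ∀ t, z 2 (t + 1) + z 2 (t - 1) = z 1 t + (z 3 t + z 6 t) := fun t => by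
    rw [hz, hN]; simp
  have r3 : ∀ t, z 3 (t + 1) + z 3 (t - 1) = z 2 t + z 4 t := fun t => by
    rw [hz, hN]; simp
  have r4 : ∀ t, z 4 (t + 1) + z 4 (t - 1) = z 3 t + z 5 t := fun t => by
    rw [hz, hN]; simp
  have r5 : ∀ t, z 5 (t + 1) + z 5 (t - 1) = z 4 t := fun t => by
    rw [hz, hN]; simp
  have r6 : ∀ t, z 6 (t + 1) + z 6 (t - 1) = z 2 t := fun t => by
    rw [hz, hN]; simp
  obtain ⟨w, hw⟩ : ∃ w : ℤ → ℤ, ∀ t, w t = z 1 t - z 6 t := ⟨_, fun _ => rfl⟩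
  obtain ⟨e0, e1, e6, e2, e3, e4⟩ := harmonic_arm hw r0 r1 r2 r3 r6
  have e5 : ∀ t, z 5 t = w (t + 6) + w (t + 4) - w t + w (t - 4) + w (t - 6) := fun t => by
    have h1 := r4 t
    rw [e4, e4, e3] at h1
    ring_nf at h1 ⊢
    linarith
  have hrec : ∀ t, w (t + 14) + w (t + 12) - w (t + 8) - w (t + 6) + w (t + 2) + w t = 0 := fun t => by
    have h1 := r5 (t + 7)
    rw [e5, e5, e4] at h1
    ring_nf at h1 ⊢
    linarith
  have ha : ∀ t, w (t + 18) = - w t := fun t => by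
    have p0 := hrec t
    have p1 := hrec (t + 2)
    have p2 := hrec (t + 4)
    ring_nf at p0 p1 p2 ⊢
    linear_combination p0 - p1 + p2
  have hp : ∀ t, w (t + 36) = w t := fun t => by
    rw [show t + 36 = t + 18 + 18 by ring, ha, ha, neg_neg]
  have hadd : ∀ a, w (t + 36 + a) = w (t + a) := fun a => by
    rw [add_right_comm, hp]
  have hsub : ∀ a, w (t + 36 - a) = w (t - a) := fun a => by
    rw [add_sub_right_comm, hp]
  fin_cases v
  · exact (by rw [e0, e0]; simp only [hadd, hsub] : z 0 (t + 36) = z 0 t)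
  · exact (by rw [e1, e1]; simp only [hadd, hsub, hp] : z 1 (t + 36) = z 1 t)
  · exact (by rw [e2, e2]; simp only [hadd, hsub] : z 2 (t + 36) = z 2 t)
  · exact (by rw [e3, e3]; simp only [hadd, hsub, hp] : z 3 (t + 36) = z 3 t)
  · exact (by rw [e4, e4]; simp only [hadd, hsub] : z 4 (t + 36) = z 4 t)
  · exact (by rw [e5, e5]; simp only [hadd, hsub, hp] : z 5 (t + 36) = z 5 t)
  · exact (by rw [e6, e6]; simp only [hadd, hsub, hp] : z 6 (t + 36) = z 6 t)

theorem IsHarmonic.periodic_E8 {Λ : SimpleGraph (Fin 8)}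
    (hΛ : ∀ i j : Fin 8, Λ.Adj i j ↔
      s(i, j) ∈ ({s(0, 1), s(1, 2), s(2, 3), s(3, 4), s(4, 5), s(5, 6), s(2, 7)} :
        Finset (Sym2 (Fin 8))))
    {z : Fin 8 → ℤ → ℤ} (hz : IsHarmonic Λ z) (v : Fin 8) (t : ℤ) :
    z v (t + 60) = z v t := by
  have hN : nbrs Λ = ![{1}, {0, 2}, {1, 3, 7}, {2, 4}, {3, 5}, {4, 6}, {5}, {2}] := by
    funext v
    ext u
    rw [mem_nbrs, hΛ]
    revert u v
    decide
  have r0 : ∀ t, z 0 (t + 1) + z 0 (t - 1) = z 1 t := fun t => by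
    rw [hz, hN]; simp
  have r1 : ∀ t, z 1 (t + 1) + z 1 (t - 1) = z 0 t + z 2 t := fun t => by
    rw [hz, hN]; simp
  have r2 : ∀ t, z 2 (t + 1) + z 2 (t - 1) = z 1 t + (z 3 t + z 7 t) := fun t => by
    rw [hz, hN]; simp
  have r3 : ∀ t, z 3 (t + 1) + z 3 (t - 1) = z 2 t + z 4 t := fun t => by
    rw [hz, hN]; simp
  have r4 : ∀ t, z 4 (t + 1) + z 4 (t - 1) = z 3 t + z 5 t := fun t => by
    rw [hz, hN]; simp
  have r5 : ∀ t, z 5 (t + 1) + z 5 (t - 1) = z 4 t + z 6 t := fun t => by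
    rw [hz, hN]; simp
  have r6 : ∀ t, z 6 (t + 1) + z 6 (t - 1) = z 5 t := fun t => by
    rw [hz, hN]; simp
  have r7 : ∀ t, z 7 (t + 1) + z 7 (t - 1) = z 2 t := fun t => by
    rw [hz, hN]; simp
  obtain ⟨w, hw⟩ : ∃ w : ℤ → ℤ, ∀ t, w t = z 1 t - z 7 t := ⟨_, fun _ => rfl⟩
  obtain ⟨e0, e1, e7, e2, e3, e4⟩ := harmonic_arm hw r0 r1 r2 r3 r7
  have e5 : ∀ t, z 5 t = w (t + 6) + w (t + 4) - w t + w (t - 4) + w (t - 6) := fun t => by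
    have h1 := r4 t
    rw [e4, e4, e3] at h1
    ring_nf at h1 ⊢
    linarith
  have e6 : ∀ t, z 6 t = w (t + 7) + w (t + 5) - w (t + 1) - w (t - 1) + w (t - 5) +
      w (t - 7) := fun t => by
    have h1 := r5 t
    rw [e5, e5, e4] at h1
    ring_nf at h1 ⊢
    linarith
  have hrec : ∀ t, w (t + 16) + w (t + 14) - w (t + 10) - w (t + 8) - w (t + 6) + w (t + 2) + w t = 0 := fun t => by
    have h1 := r6 (t + 8)
    rw [e6, e6, e5] at h1
    ring_nf at h1 ⊢
    linarith
  have ha : ∀ t, w (t + 30) = - w t := fun t => by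
    have p0 := hrec t
    have p1 := hrec (t + 2)
    have p2 := hrec (t + 4)
    have p5 := hrec (t + 10)
    have p6 := hrec (t + 12)
    have p7 := hrec (t + 14)
    ring_nf at p0 p1 p2 p5 p6 p7 ⊢
    linear_combination p0 - p1 + p2 + p5 - p6 + p7
  have hp : ∀ t, w (t + 60) = w t := fun t => by
    rw [show t + 60 = t + 30 + 30 by ring, ha, ha, neg_neg]
  have hadd : ∀ a, w (t + 60 + a) = w (t + a) := fun a => by
    rw [add_right_comm, hp]
  have hsub : ∀ a, w (t + 60 - a) = w (t - a) := fun a => by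
    rw [add_sub_right_comm, hp]
  fin_cases v
  · exact (by rw [e0, e0]; simp only [hadd, hsub] : z 0 (t + 60) = z 0 t)
  · exact (by rw [e1, e1]; simp only [hadd, hsub, hp] : z 1 (t + 60) = z 1 t)
  · exact (by rw [e2, e2]; simp only [hadd, hsub] : z 2 (t + 60) = z 2 t)
  · exact (by rw [e3, e3]; simp only [hadd, hsub, hp] : z 3 (t + 60) = z 3 t)
  · exact (by rw [e4, e4]; simp only [hadd, hsub] : z 4 (t + 60) = z 4 t)
  · exact (by rw [e5, e5]; simp only [hadd, hsub, hp] : z 5 (t + 60) = z 5 t)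
  · exact (by rw [e6, e6]; simp only [hadd, hsub] : z 6 (t + 60) = z 6 t)
  · exact (by rw [e7, e7]; simp only [hadd, hsub, hp] : z 7 (t + 60) = z 7 t)

theorem DynkinType.graph_adj (X : DynkinType) (i j : Fin X.rank) :
    X.graph.Adj i j ↔ i.1 ≠ j.1 ∧ (X.edge i j ∨ X.edge j i) := by
  simp [DynkinType.graph, SimpleGraph.fromRel_adj, Fin.ext_iff]

theorem IsHarmonic.periodic {V : Type*} [Fintype V] {Λ : SimpleGraph V} {X : DynkinType}
    (e : Λ ≃g X.graph) {z : V → ℤ → ℤ} (hz : IsHarmonic Λ z) (v : V) (t : ℤ) :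
    z v (t + 2 * X.coxeterNumber) = z v t := by
  have h := hz.comp_iso e
  obtain ⟨w, rfl⟩ := e.symm.surjective v
  revert w
  cases X with
  | A n hn =>
    refine fun w => Eq.trans ?_ (IsHarmonic.periodic_A hn ?_ h w t)
    · simp [DynkinType.coxeterNumber]
    · intro i j
      refine (DynkinType.graph_adj (DynkinType.A n hn) i j).trans ?_
      simp only [DynkinType.edge]
      omega
  | D n hn =>
    refine fun w => Eq.trans ?_ (IsHarmonic.periodic_D hn ?_ h w t)
    · congr 2
      simp only [DynkinType.coxeterNumber]
      omega
    · intro i j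
      refine (DynkinType.graph_adj (DynkinType.D n hn) i j).trans ?_
      simp only [DynkinType.edge]
      omega
  | E6 =>
    refine fun w => Eq.trans ?_ (IsHarmonic.periodic_E6 ?_ h w t)
    · simp [DynkinType.coxeterNumber]
    · intro i j
      refine (DynkinType.graph_adj DynkinType.E6 i j).trans ?_
      simp only [DynkinType.edge]
      revert i j
      decide
  | E7 =>
    refine fun w => Eq.trans ?_ (IsHarmonic.periodic_E7 ?_ h w t)
    · simp [DynkinType.coxeterNumber]
    · intro i j
      refine (DynkinType.graph_adj DynkinType.E7 i j).trans ?_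
      simp only [DynkinType.edge]
      revert i j
      decide
  | E8 =>
    refine fun w => Eq.trans ?_ (IsHarmonic.periodic_E8 ?_ h w t)
    · simp [DynkinType.coxeterNumber]
    · intro i j
      refine (DynkinType.graph_adj DynkinType.E8 i j).trans ?_
      simp only [DynkinType.edge]
      revert i j
      decide

theorem color_cases (c : Fin 2) : c = 0 ∨ c = 1 := by omega

theorem color_of_adj {V : Type*} {Λ : SimpleGraph V} {ε : V → Fin 2}
    (hε : ∀ u w, Λ.Adj u w → ε u ≠ ε w) {u v : V} (h : Λ.Adj u v) :
    ((ε u : ℕ) : ℤ) = 1 - ((ε v : ℕ) : ℤ) := by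
  have := hε u v h
  have h1 := (ε u).2
  have h2 := (ε v).2
  rw [ne_eq, Fin.ext_iff] at this
  omega

/-- The sheet reached from the sheet `i` of a twist after `k` interchanges. -/
def turn (k : ℤ) (i : Fin 2) : Fin 2 := if Even k then i else i + 1

theorem turn_turn (k l : ℤ) (i : Fin 2) : turn k (turn l i) = turn (k + l) i := by
  have : ∀ i : Fin 2, i + 1 + 1 = i := by decide
  simp only [turn, Int.even_add]
  split_ifs <;> first | rfl | exact this i | exact (this i).symm | (exfalso; tauto)

theorem turn_add_one (k : ℤ) (i : Fin 2) : turn (k + 1) i = turn k i + 1 := by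
  have : ∀ i : Fin 2, i + 1 + 1 = i := by decide
  simp only [turn, Int.even_add_one]
  split_ifs <;> first | rfl | exact (this i).symm

theorem turn_of_even {k : ℤ} (h : Even k) (i : Fin 2) : turn k i = i := if_pos h

theorem turn_of_odd {k : ℤ} (h : ¬ Even k) (i : Fin 2) : turn k i = i + 1 := if_neg h

section Recurrence

variable {V : Type*} [Fintype V] {Λ : SimpleGraph V} {ε : V → Fin 2} {A : Type*} [AddCommGroup A]

/-- The affine reflections at all vertices of colour `k`. -/
noncomputable def reflectColor (Λ : SimpleGraph V) (ε : V → Fin 2) (c : V → A) (k : Fin 2)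
    (s : V → A) (v : V) : A :=
  if ε v = k then ∑ u ∈ nbrs Λ v, s u + c v - s v else s v

theorem reflectColor_involutive (hε : ∀ u w, Λ.Adj u w → ε u ≠ ε w) (c : V → A) (k : Fin 2) :
    Function.Involutive (reflectColor Λ ε c k) := by
  intro s
  funext v
  by_cases hv : ε v = k
  · have : ∑ u ∈ nbrs Λ v, reflectColor Λ ε c k s u = ∑ u ∈ nbrs Λ v, s u :=
      sum_congr rfl fun u hu => if_neg fun h => hε u v (mem_nbrs.1 hu) (h.trans hv.symm)
    rw [reflectColor, if_pos hv, this, reflectColor, if_pos hv]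
    abel
  · rw [reflectColor, if_neg hv, reflectColor, if_neg hv]

theorem exists_recurrence (hε : ∀ u w, Λ.Adj u w → ε u ≠ ε w) (x c : V → A) :
    ∃ z : V → ℤ → A, (∀ v, z v ((ε v : ℕ) : ℤ) = x v) ∧
      ∀ v t, Even (t + 1 + ((ε v : ℕ) : ℤ)) →
        z v (t + 1) + z v (t - 1) = ∑ u ∈ nbrs Λ v, z u t + c v := by
  let f (k : Fin 2) : Equiv.Perm (V → A) := (reflectColor_involutive hε c k).toPerm
  have hf : ∀ k s v, f k s v = if ε v = k then ∑ u ∈ nbrs Λ v, s u + c v - s v else s v :=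
    fun _ _ _ => rfl
  refine ⟨fun v t => ((f 1 * f 0) ^ ((t - ((ε v : ℕ) : ℤ)) / 2)) x v, fun v => by simp, ?_⟩
  intro v t ht
  dsimp only
  rcases color_cases (ε v) with h0 | h1
  · have hu : ∀ u ∈ nbrs Λ v, ε u = 1 := fun u hu => by
      have := hε u v (mem_nbrs.1 hu)
      omega
    obtain ⟨k, rfl⟩ : ∃ k, t = 2 * k + 1 := by
      rw [h0] at ht
      obtain ⟨m, hm⟩ := ht
      exact ⟨m - 1, by simp at hm; omega⟩
    rw [sum_congr rfl fun u h => by rw [hu u h], h0]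
    rw [show (2 * k + 1 + 1 - (((0 : Fin 2) : ℕ) : ℤ)) / 2 = 1 + k by simp; omega,
      show (2 * k + 1 - 1 - (((0 : Fin 2) : ℕ) : ℤ)) / 2 = k by simp,
      show (2 * k + 1 - (((1 : Fin 2) : ℕ) : ℤ)) / 2 = k by simp]
    rw [zpow_add, zpow_one, Equiv.Perm.mul_apply, Equiv.Perm.mul_apply, hf 1, h0,
      if_neg (by decide), hf 0, h0, if_pos rfl]
    abel
  · have hu : ∀ u ∈ nbrs Λ v, ε u = 0 := fun u hu => by
      have := hε u v (mem_nbrs.1 hu)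
      omega
    obtain ⟨k, rfl⟩ : ∃ k, t = 2 * k + 2 := by
      rw [h1] at ht
      obtain ⟨m, hm⟩ := ht
      exact ⟨m - 2, by simp at hm; omega⟩
    rw [sum_congr rfl fun u h => by rw [hu u h], h1]
    rw [show (2 * k + 2 + 1 - (((1 : Fin 2) : ℕ) : ℤ)) / 2 = 1 + k by simp; omega,
      show (2 * k + 2 - 1 - (((1 : Fin 2) : ℕ) : ℤ)) / 2 = k by simp; omega,
      show (2 * k + 2 - (((0 : Fin 2) : ℕ) : ℤ)) / 2 = 1 + k by simp; omega]
    rw [zpow_add, zpow_one, Equiv.Perm.mul_apply, Equiv.Perm.mul_apply]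
    rw [hf 1 _ v, h1, if_pos rfl, hf 0 _ v, h1, if_neg (by decide)]
    have : ∀ s, ∑ u ∈ nbrs Λ v, (f 1) s u = ∑ u ∈ nbrs Λ v, s u :=
      fun s => sum_congr rfl fun u h => by rw [hf 1, hu u h, if_neg (by decide)]
    rw [this]
    abel

theorem recurrence_periodic_int {X : DynkinType} (e : Λ ≃g X.graph)
    (hε : ∀ u w, Λ.Adj u w → ε u ≠ ε w) {c : V → ℤ} {z : V → ℤ → ℤ}
    (hz : ∀ v t, Even (t + 1 + ((ε v : ℕ) : ℤ)) →
        z v (t + 1) + z v (t - 1) = ∑ u ∈ nbrs Λ v, z u t + c v)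
    (v : V) (t : ℤ) (ht : Even (t + ((ε v : ℕ) : ℤ))) :
    z v (t + 2 * X.coxeterNumber) = z v t := by
  classical
  have hpar : ∀ u v t, Λ.Adj u v → (Even (t + ((ε u : ℕ) : ℤ)) ↔ Even (t + 1 + ((ε v : ℕ) : ℤ))) :=
    fun u v t h => by rw [color_of_adj hε h]; grind
  -- the increments satisfy the homogeneous recurrence
  have hw : IsHarmonic Λ fun v t => if Even (t + ((ε v : ℕ) : ℤ)) then z v (t + 2) - z v t else 0 := by
    intro v t
    dsimp only
    by_cases h : Even (t + 1 + ((ε v : ℕ) : ℤ))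
    · rw [sum_congr rfl fun u hu => if_pos ((hpar u v t (mem_nbrs.1 hu)).2 h), sum_sub_distrib,
        if_pos h, if_pos (by grind)]
      have h1 := hz v t h
      have h2 := hz v (t + 2) (by grind)
      rw [show t + 2 + 1 = t + 1 + 2 by ring, show t + 2 - 1 = t - 1 + 2 by ring] at h2
      linarith
    · rw [sum_congr rfl fun u hu => if_neg fun h' => h ((hpar u v t (mem_nbrs.1 hu)).1 h'),
        sum_const_zero, if_neg h, if_neg (by grind), add_zero]
  set N : ℤ := 2 * X.coxeterNumber with hN
  have hNe : Even N := ⟨X.coxeterNumber, by rw [hN]; ring⟩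
  have hd : ∀ v t, Even (t + ((ε v : ℕ) : ℤ)) →
      z v (t + 2 + N) - z v (t + 2) = z v (t + N) - z v t := by
    intro v t h
    have := hw.periodic e v t
    rw [if_pos h, if_pos (by grind)] at this
    rw [show t + 2 + N = t + N + 2 by ring]
    linarith
  obtain ⟨d, hd0⟩ : ∃ d : V → ℤ, d = fun v => z v ((ε v : ℕ) + N) - z v (ε v : ℕ) := ⟨_, rfl⟩
  have hdk : ∀ v (k : ℤ), z v ((ε v : ℕ) + 2 * k + N) - z v ((ε v : ℕ) + 2 * k) = d v := by
    intro v k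
    induction k with
    | zero => simp [hd0]
    | succ k ih =>
      rw [← ih, ← hd v ((ε v : ℕ) + 2 * k) (by grind)]
      congr 2
    | pred k ih =>
      rw [← ih, show ((ε v : ℕ) : ℤ) + 2 * (-(k : ℤ)) = (ε v : ℕ) + 2 * (-k - 1) + 2 by ring,
        ← hd v _ (by grind)]
  have hdt : ∀ v t, Even (t + ((ε v : ℕ) : ℤ)) → z v (t + N) - z v t = d v := by
    intro v t h
    obtain ⟨k, rfl⟩ : ∃ k, t = (ε v : ℕ) + 2 * k := by
      obtain ⟨m, hm⟩ := h
      exact ⟨m - (ε v : ℕ), by linarith⟩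
    exact hdk v k
  have hker : ∀ v, 2 * d v = ∑ u ∈ nbrs Λ v, d u := by
    intro v
    obtain ⟨t, h⟩ : ∃ t : ℤ, Even (t + 1 + ((ε v : ℕ) : ℤ)) := ⟨-1 - (ε v : ℕ), 0, by ring⟩
    have h1 := hz v t h
    have h2 := hz v (t + N) (by grind)
    have h3 := hdt v (t - 1) (by grind)
    have h4 := hdt v (t + 1) h
    rw [sum_congr rfl fun u hu => (hdt u t ((hpar u v t (mem_nbrs.1 hu)).2 h)).symm,
      sum_sub_distrib]
    rw [show t + N + 1 = t + 1 + N by ring, show t + N - 1 = t - 1 + N by ring] at h2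
    linarith
  have hlin : IsHarmonic Λ fun v t => t * d v := by
    intro v t
    rw [← mul_sum, ← hker]
    ring
  have h0 := hlin.periodic e v 0
  have hNpos : N ≠ 0 := by
    cases X <;> simp [hN, DynkinType.coxeterNumber] <;> omega
  simp only [zero_add, zero_mul, ← hN, mul_eq_zero, hNpos, false_or] at h0
  linarith [hdt v t ht]

theorem exists_periodic_recurrence {X : DynkinType} (e : Λ ≃g X.graph)
    (hε : ∀ u w, Λ.Adj u w → ε u ≠ ε w) (x c : V → A) :
    ∃ z : V → ℤ → A, (∀ v, z v ((ε v : ℕ) : ℤ) = x v) ∧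
      (∀ v t, Even (t + 1 + ((ε v : ℕ) : ℤ)) →
        z v (t + 1) + z v (t - 1) = ∑ u ∈ nbrs Λ v, z u t + c v) ∧
      ∀ v t, Even (t + ((ε v : ℕ) : ℤ)) → z v (t + 2 * X.coxeterNumber) = z v t := by
  classical
  obtain ⟨U, hU0, hU⟩ := exists_recurrence (A := V ⊕ V → ℤ) hε
    (fun v => Pi.single (Sum.inl v) 1) (fun v => Pi.single (Sum.inr v) 1)
  have hUp : ∀ v t, Even (t + ((ε v : ℕ) : ℤ)) → U v (t + 2 * X.coxeterNumber) = U v t := by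
    intro v t ht
    funext j
    refine recurrence_periodic_int (z := fun v t => U v t j)
      (c := fun v => (Pi.single (Sum.inr v) 1 : V ⊕ V → ℤ) j) e hε (fun v t h => ?_) v t ht
    have := congrFun (hU v t h) j
    simpa using this
  let φ : (V ⊕ V → ℤ) →+ A :=
    { toFun := fun w => ∑ j, w j • Sum.elim x c j
      map_zero' := by simp
      map_add' := fun w w' => by simp [add_smul, sum_add_distrib] }
  have hφ : ∀ j, φ (Pi.single j 1) = Sum.elim x c j := by
    intro j
    change ∑ i, (Pi.single j 1 : V ⊕ V → ℤ) i • Sum.elim x c i = _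
    rw [sum_eq_single j (fun i _ h => by rw [Pi.single_eq_of_ne h, zero_smul]) (by simp)]
    simp
  refine ⟨fun v t => φ (U v t), fun v => ?_, fun v t h => ?_, fun v t h => ?_⟩
  · dsimp only
    rw [hU0, hφ, Sum.elim_inl]
  · rw [← map_add, hU v t h, map_add, map_sum, hφ, Sum.elim_inr]
  · dsimp only
    rw [hUp v t h]

/-- The solution of the twisted recurrence. -/
theorem exists_twisted_recurrence {X : DynkinType} (e : Λ ≃g X.graph)
    (hε : ∀ u w, Λ.Adj u w → ε u ≠ ε w) (x : V × Fin 2 → A) (G : V → A) :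
    ∃ τ : V × Fin 2 → ℤ → A, (∀ a, τ a ((ε a.1 : ℕ) : ℤ) = x a) ∧
      (∀ v t, Even (t + 1 + ((ε v : ℕ) : ℤ)) →
        ((∀ i, τ (v, i) (t + 1) + τ (v, i) (t - 1) = ∑ u ∈ nbrs Λ v, τ (u, 1) t + G v) ∧
          ∑ u ∈ nbrs Λ v, τ (u, 0) t =
            ∑ u ∈ nbrs Λ v, τ (u, 1) t + ∑ u ∈ nbrs Λ v, (x (u, 0) - x (u, 1))) ∨
        ((∀ i, τ (v, i) (t + 1) + τ (v, i) (t - 1) = ∑ u ∈ nbrs Λ v, τ (u, 0) t + G v) ∧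
          ∑ u ∈ nbrs Λ v, τ (u, 1) t =
            ∑ u ∈ nbrs Λ v, τ (u, 0) t + ∑ u ∈ nbrs Λ v, (x (u, 0) - x (u, 1)))) ∧
      ∀ v i t, Even (t + ((ε v : ℕ) : ℤ)) →
        τ (v, i) (t + 2 * X.coxeterNumber) = τ (v, turn X.coxeterNumber i) t := by
  obtain ⟨z, hz0, hz, hzp⟩ := exists_periodic_recurrence e hε (fun v => x (v, 1))
    (fun v => G v - (x (v, 0) - x (v, 1)))
  let τ (a : V × Fin 2) (t : ℤ) : A := z a.1 t +
    if turn ((t - ((ε a.1 : ℕ) : ℤ)) / 2) a.2 = 0 then x (a.1, 0) - x (a.1, 1) else 0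
  have hτ : ∀ v i t, τ (v, i) t = z v t +
    if turn ((t - ((ε v : ℕ) : ℤ)) / 2) i = 0 then x (v, 0) - x (v, 1) else 0 := fun _ _ _ => rfl
  refine ⟨τ, ?_, ?_, ?_⟩
  · rintro ⟨v, i⟩
    rw [hτ]
    dsimp only
    rw [hz0, sub_self, Int.zero_ediv, turn_of_even (by simp)]
    rcases color_cases i with rfl | rfl <;> simp
  · intro v t h
    have hl : ∀ i, τ (v, i) (t + 1) + τ (v, i) (t - 1) = ∑ u ∈ nbrs Λ v, z u t + G v := by
      intro i
      have e1 : (t + 1 - ((ε v : ℕ) : ℤ)) / 2 = (t - 1 - ((ε v : ℕ) : ℤ)) / 2 + 1 := by omega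
      rw [hτ, hτ, e1, turn_add_one]
      have := hz v t h
      rcases color_cases (turn ((t - 1 - ((ε v : ℕ) : ℤ)) / 2) i) with h | h
      · rw [h, if_neg (by decide), if_pos rfl, add_zero, ← add_assoc, this]
        abel
      · rw [h, if_pos (by decide), if_neg (by decide), add_zero, add_right_comm, this]
        abel
    have hu : ∀ u ∈ nbrs Λ v, ((ε u : ℕ) : ℤ) = 1 - ((ε v : ℕ) : ℤ) :=
      fun u hu => color_of_adj hε (mem_nbrs.1 hu)
    have hs : ∀ i, ∑ u ∈ nbrs Λ v, τ (u, i) t = ∑ u ∈ nbrs Λ v, z u t +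
        if turn ((t - (1 - ((ε v : ℕ) : ℤ))) / 2) i = 0 then
          ∑ u ∈ nbrs Λ v, (x (u, 0) - x (u, 1)) else 0 := by
      intro i
      rw [sum_congr rfl fun u h => by rw [hτ, hu u h], sum_add_distrib]
      split_ifs <;> simp
    by_cases hk : Even ((t - (1 - ((ε v : ℕ) : ℤ))) / 2)
    · left
      rw [hs, hs, turn_of_even hk, turn_of_even hk, if_pos rfl, if_neg (by decide), add_zero]
      exact ⟨hl, rfl⟩
    · right
      rw [hs, hs, turn_of_odd hk, turn_of_odd hk, if_neg (by decide), if_pos (by decide), add_zero]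
      exact ⟨hl, rfl⟩
  · intro v i t h
    rw [hτ, hτ, hzp v t h, turn_turn]
    congr 4
    omega

end Recurrence

section TSystem

variable {V : Type*} {Λ : SimpleGraph V} {ε : V → Fin 2}

/-- The sheet of the tails of the arrows into a vertex of colour `c` on the sheet `i`. -/
def sheetIn (c i : Fin 2) : Fin 2 := if c = 1 then i else i + 1

/-- The sheet of the heads of the arrows out of a vertex of colour `c` on the sheet `i`. -/
def sheetOut (c i : Fin 2) : Fin 2 := if c = 1 then i + 1 else i

theorem sheet_comm {M : Type*} {op : M → M → M} (hop : ∀ a b, op a b = op b a) (f : Fin 2 → M)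
    (c i : Fin 2) : op (f (sheetIn c i)) (f (sheetOut c i)) = op (f 0) (f 1) := by
  have h11 : (1 : Fin 2) + 1 = 0 := by decide
  rcases color_cases c with rfl | rfl <;> rcases color_cases i with rfl | rfl <;>
    simp [sheetIn, sheetOut, hop (f 1), h11]

open Classical in
theorem twistQuiver_arrows_in (hε : ∀ u w, Λ.Adj u w → ε u ≠ ε w) (a b : V × Fin 2) :
    (twistQuiver Λ ε).arrows a b =
      if Λ.Adj a.1 b.1 ∧ a.2 = sheetIn (ε b.1) b.2 then 1 else 0 := by
  obtain ⟨a, i⟩ := a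
  obtain ⟨b, j⟩ := b
  simp only [twistQuiver, Bigraph.toQuiver, twist, twistColor, sheetIn]
  by_cases h : Λ.Adj a b
  · have := hε a b h
    simp only [h, true_and]
    generalize ε a = c at *
    generalize ε b = d at *
    revert c d i j
    decide
  · simp [h]

open Classical in
theorem twistQuiver_arrows_out (hε : ∀ u w, Λ.Adj u w → ε u ≠ ε w) (a b : V × Fin 2) :
    (twistQuiver Λ ε).arrows a b =
      if Λ.Adj b.1 a.1 ∧ b.2 = sheetOut (ε a.1) a.2 then 1 else 0 := by
  rw [twistQuiver_arrows_in hε, Λ.adj_comm]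
  obtain ⟨a, i⟩ := a
  obtain ⟨b, j⟩ := b
  simp only [sheetIn, sheetOut]
  by_cases h : Λ.Adj b a
  · have := hε b a h
    simp only [h, true_and]
    generalize ε a = c at *
    generalize ε b = d at *
    revert c d i j
    decide
  · simp [h]

theorem eq_of_step {K : Type*} (hε : ∀ u w, Λ.Adj u w → ε u ≠ ε w) {f g : V × Fin 2 → ℤ → K}
    (h0 : ∀ a, f a ((ε a.1 : ℕ) : ℤ) = g a ((ε a.1 : ℕ) : ℤ))
    (hs : ∀ a t, Even (t + 1 + ((ε a.1 : ℕ) : ℤ)) →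
      (∀ u i, Λ.Adj u a.1 → f (u, i) t = g (u, i) t) →
      (f a (t + 1) = g a (t + 1) ↔ f a (t - 1) = g a (t - 1)))
    (a : V × Fin 2) (t : ℤ) (ht : Even (t + ((ε a.1 : ℕ) : ℤ))) : f a t = g a t := by
  have key : ∀ (n : ℕ) (a : V × Fin 2) (t : ℤ), Even (t + ((ε a.1 : ℕ) : ℤ)) →
      -(n : ℤ) ≤ t → t ≤ n + 1 → f a t = g a t := by
    intro n
    induction n with
    | zero =>
      intro a t ht h1 h2
      have h3 := (ε a.1).2
      have : t = ((ε a.1 : ℕ) : ℤ) := by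
        obtain ⟨m, hm⟩ := ht
        push_cast at h1 h2
        omega
      rw [this, h0]
    | succ n ih =>
      intro a t ht h1 h2
      push_cast at h1 h2
      have hn : ∀ s, Even (s + 1 + ((ε a.1 : ℕ) : ℤ)) → -(n : ℤ) ≤ s → s ≤ n + 1 →
          ∀ u i, Λ.Adj u a.1 → f (u, i) s = g (u, i) s := by
        intro s hs h1 h2 u i hu
        refine ih (u, i) s ?_ h1 h2
        rw [color_of_adj hε hu]
        grind
      rcases eq_or_ne t (n + 2) with rfl | h3
      · have := hs a (n + 1) (by grind) (hn _ (by grind) (by omega) (by omega))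
        rw [add_assoc, add_sub_cancel_right] at this
        exact this.2 (ih a n (by grind) (by omega) (by omega))
      · rcases eq_or_ne t (-n - 1) with rfl | h4
        · have := hs a (-n) (by grind) (hn _ (by grind) (by omega) (by omega))
          exact this.1 (ih a (-n + 1) (by grind) (by omega) (by omega))
        · exact ih a t ht (by omega) (by omega)
  exact key t.natAbs a t ht (by omega) (by omega)

theorem isPeriodicWith_of_turn {K : Type*} {X : DynkinType} {T : V × Fin 2 → ℤ → K}
    (h : ∀ v i t, Even (t + ((ε v : ℕ) : ℤ)) →
        T (v, i) (t + 2 * X.coxeterNumber) = T (v, turn X.coxeterNumber i) t) :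
    IsPeriodicWith (twistColor ε) T (2 * X.coxeterNumber) := by
  constructor
  · cases X <;> simp [DynkinType.coxeterNumber]
    omega
  · rintro ⟨v, i⟩ t (ht : Even (t + ((ε v : ℕ) : ℤ)))
    rw [show t + 2 * ((2 * X.coxeterNumber : ℕ) : ℤ) =
      t + 2 * X.coxeterNumber + 2 * X.coxeterNumber by push_cast; ring, h _ _ _ (by grind),
      h _ _ _ ht, turn_turn, turn_of_even ⟨_, rfl⟩]

theorem IsPeriodicWith.congr {K : Type*} {T T' : V × Fin 2 → ℤ → K} {N : ℕ}
    (h : IsPeriodicWith (twistColor ε) T N)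
    (hT : ∀ a t, Even (t + ((ε a.1 : ℕ) : ℤ)) → T a t = T' a t) :
    IsPeriodicWith (twistColor ε) T' N := by
  refine ⟨h.1, fun a t (ht : Even (t + ((ε a.1 : ℕ) : ℤ))) => ?_⟩
  rw [← hT a t ht, ← hT a _ (by grind), h.2 a t ht]

variable [Fintype V]

@[to_additive]
theorem prod_pow_sheet {M : Type*} [CommMonoid M] (F : V × Fin 2 → M) (n : V × Fin 2 → ℕ) (v : V)
    (j : Fin 2) (hn : ∀ a, n a = open Classical in if Λ.Adj a.1 v ∧ a.2 = j then 1 else 0) :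
    ∏ a, F a ^ n a = ∏ u ∈ nbrs Λ v, F (u, j) := by
  classical
  rw [Fintype.prod_prod_type, nbrs, prod_filter]
  refine prod_congr rfl fun u _ => ?_
  by_cases h : Λ.Adj u v
  · rw [prod_eq_single j]
    · simp [hn, h]
    · intro i _ hi
      simp [hn, hi]
    · simp
  · simp [hn, h]

theorem prod_in_add_prod_out {K : Type*} [CommSemiring K] (hε : ∀ u w, Λ.Adj u w → ε u ≠ ε w)
    (F : V × Fin 2 → K) (a : V × Fin 2) :
    (∏ u, F u ^ (twistQuiver Λ ε).arrows u a) + ∏ w, F w ^ (twistQuiver Λ ε).arrows a w =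
      ∏ u ∈ nbrs Λ a.1, F (u, 0) + ∏ u ∈ nbrs Λ a.1, F (u, 1) := by
  rw [prod_pow_sheet F _ a.1 _ fun b => twistQuiver_arrows_in hε b a,
    prod_pow_sheet F _ a.1 _ fun b => twistQuiver_arrows_out hε a b]
  exact sheet_comm add_comm (fun i => ∏ u ∈ nbrs Λ a.1, F (u, i)) _ _

theorem max_sum_in_sum_out (hε : ∀ u w, Λ.Adj u w → ε u ≠ ε w) (F : V × Fin 2 → ℝ)
    (a : V × Fin 2) :
    max (∑ u, ((twistQuiver Λ ε).arrows u a : ℝ) * F u)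
        (∑ w, ((twistQuiver Λ ε).arrows a w : ℝ) * F w) =
      max (∑ u ∈ nbrs Λ a.1, F (u, 0)) (∑ u ∈ nbrs Λ a.1, F (u, 1)) := by
  simp only [← nsmul_eq_mul]
  rw [sum_nsmul_sheet F _ a.1 _ fun b => twistQuiver_arrows_in hε b a,
    sum_nsmul_sheet F _ a.1 _ fun b => twistQuiver_arrows_out hε a b]
  exact sheet_comm max_comm (fun i => ∑ u ∈ nbrs Λ a.1, F (u, i)) _ _

/-- The right-hand side of the `T`-system of a twist. -/
noncomputable def exchangeSum {K : Type*} [CommSemiring K] (Λ : SimpleGraph V)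
    (F : V × Fin 2 → K) (v : V) : K :=
  ∏ u ∈ nbrs Λ v, F (u, 0) + ∏ u ∈ nbrs Λ v, F (u, 1)

theorem exchangeSum_congr {K : Type*} [CommSemiring K] {F F' : V × Fin 2 → K} {v : V}
    (h : ∀ u i, Λ.Adj u v → F (u, i) = F' (u, i)) : exchangeSum Λ F v = exchangeSum Λ F' v := by
  rw [exchangeSum, prod_congr rfl fun u hu => h u 0 (mem_nbrs.1 hu),
    prod_congr rfl fun u hu => h u 1 (mem_nbrs.1 hu), exchangeSum]

theorem isTSystem_twist_iff {K : Type*} [CommSemiring K] (hε : ∀ u w, Λ.Adj u w → ε u ≠ ε w)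
    {x : V × Fin 2 → K} {T : V × Fin 2 → ℤ → K} :
    IsTSystem (twistQuiver Λ ε) (twistColor ε) x T ↔
      (∀ a, T a ((ε a.1 : ℕ) : ℤ) = x a) ∧ ∀ a t, Even (t + 1 + ((ε a.1 : ℕ) : ℤ)) →
        T a (t + 1) * T a (t - 1) = exchangeSum Λ (fun b => T b t) a.1 := by
  simp only [IsTSystem, prod_in_add_prod_out hε (fun b => T b _)]
  rfl

theorem isTropicalTSystem_twist_iff (hε : ∀ u w, Λ.Adj u w → ε u ≠ ε w)
    {x : V × Fin 2 → ℝ} {T : V × Fin 2 → ℤ → ℝ} :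
    IsTropicalTSystem (twistQuiver Λ ε) (twistColor ε) x T ↔
      (∀ a, T a ((ε a.1 : ℕ) : ℤ) = x a) ∧ ∀ a t, Even (t + 1 + ((ε a.1 : ℕ) : ℤ)) →
        T a (t + 1) + T a (t - 1) =
          max (∑ u ∈ nbrs Λ a.1, T (u, 0) t) (∑ u ∈ nbrs Λ a.1, T (u, 1) t) := by
  simp only [IsTropicalTSystem, max_sum_in_sum_out hε (fun b => T b _)]
  rfl

variable {X : DynkinType}

theorem exists_tropicalTSystem (e : Λ ≃g X.graph) (hε : ∀ u w, Λ.Adj u w → ε u ≠ ε w)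
    (l : V × Fin 2 → ℝ) :
    ∃ τ, IsTropicalTSystem (twistQuiver Λ ε) (twistColor ε) l τ ∧
      ∀ v i t, Even (t + ((ε v : ℕ) : ℤ)) →
        τ (v, i) (t + 2 * X.coxeterNumber) = τ (v, turn X.coxeterNumber i) t := by
  obtain ⟨τ, h0, h1, h2⟩ := exists_twisted_recurrence e hε l
    fun v => max (∑ u ∈ nbrs Λ v, (l (u, 0) - l (u, 1))) 0
  refine ⟨τ, (isTropicalTSystem_twist_iff hε).2 ⟨h0, fun a t h => ?_⟩, h2⟩
  rcases h1 a.1 t h with ⟨h3, h4⟩ | ⟨h3, h4⟩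
  · rw [h3 a.2, h4, ← max_add_add_left, add_zero]
  · rw [h3 a.2, h4, ← max_add_add_left, add_zero, max_comm]

theorem IsTropicalTSystem.unique (hε : ∀ u w, Λ.Adj u w → ε u ≠ ε w) {l : V × Fin 2 → ℝ}
    {τ τ' : V × Fin 2 → ℤ → ℝ} (h : IsTropicalTSystem (twistQuiver Λ ε) (twistColor ε) l τ)
    (h' : IsTropicalTSystem (twistQuiver Λ ε) (twistColor ε) l τ') (a : V × Fin 2) (t : ℤ)
    (ht : Even (t + ((ε a.1 : ℕ) : ℤ))) : τ a t = τ' a t := by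
  rw [isTropicalTSystem_twist_iff hε] at h h'
  refine eq_of_step hε (fun a => by rw [h.1, h'.1]) (fun a t ht hu => ?_) a t ht
  have h1 := h.2 a t ht
  have h2 := h'.2 a t ht
  rw [sum_congr rfl fun u h => hu u 0 (mem_nbrs.1 h),
    sum_congr rfl fun u h => hu u 1 (mem_nbrs.1 h), ← h2] at h1
  constructor <;> intro h3 <;> linarith

theorem exists_TSystem {K : Type*} [Field K] (e : Λ ≃g X.graph)
    (hε : ∀ u w, Λ.Adj u w → ε u ≠ ε w) {x : V × Fin 2 → K} (hx : ∀ a, x a ≠ 0)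
    (hx' : ∀ v, exchangeSum Λ x v ≠ 0) :
    ∃ T, IsTSystem (twistQuiver Λ ε) (twistColor ε) x T ∧ (∀ a t, T a t ≠ 0) ∧
      ∀ v i t, Even (t + ((ε v : ℕ) : ℤ)) →
        T (v, i) (t + 2 * X.coxeterNumber) = T (v, turn X.coxeterNumber i) t := by
  have hG : ∀ v, ∏ u ∈ nbrs Λ v, (x (u, 0) / x (u, 1)) + 1 ≠ 0 := by
    intro v h
    have hp : ∏ u ∈ nbrs Λ v, x (u, 1) ≠ 0 := prod_ne_zero_iff.2 fun u _ => hx _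
    refine hx' v ?_
    rw [prod_div_distrib] at h
    field_simp at h
    rwa [mul_zero] at h
  obtain ⟨τ, h0, h1, h2⟩ := exists_twisted_recurrence (A := Additive Kˣ) e hε
    (fun a => Additive.ofMul (Units.mk0 (x a) (hx a)))
    fun v => Additive.ofMul (Units.mk0 _ (hG v))
  have hsum : ∀ (s : Finset V) (f : V → Additive Kˣ),
      (((∑ u ∈ s, f u).toMul : Kˣ) : K) = ∏ u ∈ s, ((f u).toMul : K) := fun s f => by
    rw [toMul_sum, Units.coe_prod]
  refine ⟨fun a t => ((τ a t).toMul : K), (isTSystem_twist_iff hε).2 ⟨fun a => ?_, fun a t h => ?_⟩,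
    fun a t => Units.ne_zero _, fun v i t h => by dsimp only; rw [h2 v i t h]⟩
  · rw [h0]
    rfl
  · rw [exchangeSum]
    rcases h1 a.1 t h with ⟨h3, h4⟩ | ⟨h3, h4⟩
    · have h5 := congrArg (fun y : Additive Kˣ => (y.toMul : K)) (h3 a.2)
      have h6 := congrArg (fun y : Additive Kˣ => (y.toMul : K)) h4
      simp only [toMul_add, Units.val_mul, hsum, toMul_sub, Units.val_div_eq_div_val, toMul_ofMul,
        Units.val_mk0] at h5 h6
      rw [h5, h6]
      ring
    · have h5 := congrArg (fun y : Additive Kˣ => (y.toMul : K)) (h3 a.2)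
      have h6 := congrArg (fun y : Additive Kˣ => (y.toMul : K)) h4
      simp only [toMul_add, Units.val_mul, hsum, toMul_sub, Units.val_div_eq_div_val, toMul_ofMul,
        Units.val_mk0] at h5 h6
      rw [h5, h6]
      ring

theorem IsTSystem.unique {K : Type*} [Field K] (hε : ∀ u w, Λ.Adj u w → ε u ≠ ε w)
    {x : V × Fin 2 → K} {T T' : V × Fin 2 → ℤ → K}
    (h : IsTSystem (twistQuiver Λ ε) (twistColor ε) x T) (h0 : ∀ a t, T a t ≠ 0)
    (h' : IsTSystem (twistQuiver Λ ε) (twistColor ε) x T') (a : V × Fin 2) (t : ℤ)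
    (ht : Even (t + ((ε a.1 : ℕ) : ℤ))) : T a t = T' a t := by
  rw [isTSystem_twist_iff hε] at h h'
  refine eq_of_step hε (fun a => by rw [h.1, h'.1]) (fun a t ht hu => ?_) a t ht
  have h1 := h.2 a t ht
  have h2 := h'.2 a t ht
  rw [exchangeSum_congr (F' := fun b => T' b t) fun u i hu' => hu u i hu', ← h2] at h1
  constructor <;> intro h3
  · rw [← h3] at h1
    exact mul_left_cancel₀ (h0 _ _) h1
  · rw [← h3] at h1
    exact mul_right_cancel₀ (h0 _ _) h1

theorem RatFun.x_ne_zero {W : Type*} (a : W) : (RatFun.x a : RatFun W) ≠ 0 := by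
  simp [RatFun.x]

theorem RatFun.exchangeSum_ne_zero (v : V) :
    exchangeSum Λ (RatFun.x : V × Fin 2 → RatFun (V × Fin 2)) v ≠ 0 := by
  have h : exchangeSum Λ (RatFun.x : V × Fin 2 → RatFun (V × Fin 2)) v =
      algebraMap (MvPolynomial (V × Fin 2) ℚ) (RatFun (V × Fin 2))
        (exchangeSum Λ MvPolynomial.X v) := by
    simp [exchangeSum, RatFun.x]
  rw [h, ne_eq, FaithfulSMul.algebraMap_eq_zero_iff]
  intro h0
  have := congrArg (MvPolynomial.eval fun _ => (1 : ℚ)) h0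
  simp [exchangeSum] at this

end TSystem

/-! ### Mutations of labeled quivers -/

theorem compList_mutate {W : Type*} [Fintype W] [DecidableEq W] (q : LabeledQuiver W) {l : List W}
    (hl : l.Nodup) (hind : ∀ a ∈ l, ∀ b ∈ l, q.quiver.arrows a b = 0) :
    (∀ u w, (compList LabeledQuiver.mutate l q).quiver.arrows u w =
      if u ∈ l ∨ w ∈ l then q.quiver.arrows w u else
        (q.quiver.arrows u w + ∑ v ∈ l.toFinset, q.quiver.arrows u v * q.quiver.arrows v w) -
        (q.quiver.arrows w u + ∑ v ∈ l.toFinset, q.quiver.arrows w v * q.quiver.arrows v u)) ∧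
    ∀ a, (compList LabeledQuiver.mutate l q).label a =
      if a ∈ l then
        ((∏ u, q.label u ^ q.quiver.arrows u a) + ∏ w, q.label w ^ q.quiver.arrows a w) / q.label a
      else q.label a := by
  induction l with
  | nil =>
    refine ⟨fun u w => ?_, fun a => by simp [compList]⟩
    have := q.quiver.no_two_cycle u w
    simp only [compList, id_eq, List.not_mem_nil, or_self, if_false, List.toFinset_nil, sum_empty,
      add_zero]
    omega
  | cons v l ih =>
    obtain ⟨hv, hl⟩ := List.nodup_cons.1 hl
    obtain ⟨ihq, ihl⟩ := ih hl fun a ha b hb =>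
      hind a (List.mem_cons_of_mem _ ha) b (List.mem_cons_of_mem _ hb)
    set q' := compList LabeledQuiver.mutate l q with hq'
    have hvl : ∀ a ∈ l, q.quiver.arrows a v = 0 ∧ q.quiver.arrows v a = 0 := fun a ha =>
      ⟨hind a (List.mem_cons_of_mem _ ha) v List.mem_cons_self,
        hind v List.mem_cons_self a (List.mem_cons_of_mem _ ha)⟩
    have hin : ∀ u, q'.quiver.arrows u v = q.quiver.arrows u v := by
      intro u
      rw [ihq]
      by_cases hu : u ∈ l
      · rw [if_pos (Or.inl hu), (hvl u hu).1, (hvl u hu).2]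
      · rw [if_neg (by tauto), sum_eq_zero, sum_eq_zero]
        · have := q.quiver.no_two_cycle u v
          omega
        · intro x hx
          rw [(hvl x (List.mem_toFinset.1 hx)).2, zero_mul]
        · intro x hx
          rw [(hvl x (List.mem_toFinset.1 hx)).1, mul_zero]
    have hout : ∀ u, q'.quiver.arrows v u = q.quiver.arrows v u := by
      intro u
      rw [ihq]
      by_cases hu : u ∈ l
      · rw [if_pos (Or.inr hu), (hvl u hu).1, (hvl u hu).2]
      · rw [if_neg (by tauto), sum_eq_zero, sum_eq_zero]
        · have := q.quiver.no_two_cycle u v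
          omega
        · intro x hx
          rw [(hvl x (List.mem_toFinset.1 hx)).1, mul_zero]
        · intro x hx
          rw [(hvl x (List.mem_toFinset.1 hx)).2, zero_mul]
    refine ⟨fun u w => ?_, fun a => ?_⟩
    · change (if u = v ∨ w = v then q'.quiver.arrows w u else
        (q'.quiver.arrows u w + q'.quiver.arrows u v * q'.quiver.arrows v w) -
        (q'.quiver.arrows w u + q'.quiver.arrows w v * q'.quiver.arrows v u)) = _
      by_cases h : u = v ∨ w = v
      · rw [if_pos h, if_pos (by rcases h with rfl | rfl <;> simp)]
        rcases h with rfl | rfl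
        · exact hin w
        · exact hout u
      · rw [if_neg h, hin, hin, hout, hout]
        push Not at h
        have h2 := q.quiver.no_two_cycle u w
        by_cases hu : u ∈ l
        · rw [if_pos (Or.inl (List.mem_cons_of_mem _ hu)), ihq, ihq, if_pos (Or.inl hu),
            if_pos (Or.inr hu), (hvl u hu).1, (hvl u hu).2]
          omega
        · by_cases hw : w ∈ l
          · rw [if_pos (Or.inr (List.mem_cons_of_mem _ hw)), ihq, ihq, if_pos (Or.inr hw),
              if_pos (Or.inl hw), (hvl w hw).1, (hvl w hw).2]
            omega
          · rw [if_neg (by simp [*]), ihq, ihq, if_neg (by tauto), if_neg (by tauto),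
              List.toFinset_cons, sum_insert (by simpa using hv), sum_insert (by simpa using hv)]
            omega
    · change Function.update q'.label v (((∏ u, q'.label u ^ q'.quiver.arrows u v) +
        ∏ w, q'.label w ^ q'.quiver.arrows v w) / q'.label v) a = _
      by_cases ha : a = v
      · subst ha
        rw [Function.update_self, if_pos List.mem_cons_self, ihl a, if_neg hv]
        congr 2
        · refine prod_congr rfl fun u _ => ?_
          rw [hin, ihl]
          split_ifs with hu
          · rw [(hvl u hu).1, pow_zero, pow_zero]
          · rfl
        · refine prod_congr rfl fun u _ => ?_
          rw [hout, ihl]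
          split_ifs with hu
          · rw [(hvl u hu).2, pow_zero, pow_zero]
          · rfl
      · rw [Function.update_of_ne ha, ihl]
        simp only [List.mem_cons, ha, false_or]

section Twist

variable {V : Type*} {Λ : SimpleGraph V} {ε : V → Fin 2}

/-- The interchange of the two sheets of a twist. -/
def flipSheet (a : V × Fin 2) : V × Fin 2 := (a.1, a.2 + 1)

@[simp]
theorem flipSheet_flipSheet (a : V × Fin 2) : flipSheet (flipSheet a) = a := by
  have : ∀ i : Fin 2, i + 1 + 1 = i := by decide
  simp [flipSheet, this]

@[simp]
theorem flipSheet_fst (a : V × Fin 2) : (flipSheet a).1 = a.1 := rfl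

theorem swap_eq_flipSheet [DecidableEq V] (v : V) (a : V × Fin 2) :
    Equiv.swap (v, (0 : Fin 2)) (v, 1) a = if a.1 = v then flipSheet a else a := by
  obtain ⟨u, i⟩ := a
  by_cases h : u = v
  · subst h
    rcases color_cases i with rfl | rfl
    · simp [flipSheet]
    · simp [flipSheet]
  · rw [if_neg h, Equiv.swap_apply_of_ne_of_ne] <;> simp [h]

/-- Arrows into `b` correspond to arrows out of the vertex on the other sheet. -/
theorem twistQuiver_arrows_flipSheet (hε : ∀ u w, Λ.Adj u w → ε u ≠ ε w) (a b : V × Fin 2) :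
    (twistQuiver Λ ε).arrows (flipSheet b) a = (twistQuiver Λ ε).arrows a b := by
  rw [twistQuiver_arrows_in hε a b, twistQuiver_arrows_out hε]
  have : sheetOut (ε (flipSheet b).1) (flipSheet b).2 = sheetIn (ε b.1) b.2 := by
    have h : ∀ i : Fin 2, i + 1 + 1 = i := by decide
    simp [flipSheet, sheetIn, sheetOut, h]
  rw [this, flipSheet_fst]

theorem twistQuiver_arrows_of_not_adj (hε : ∀ u w, Λ.Adj u w → ε u ≠ ε w) {a b : V × Fin 2}
    (h : ¬ Λ.Adj a.1 b.1) : (twistQuiver Λ ε).arrows a b = 0 := by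
  rw [twistQuiver_arrows_in hε, if_neg (by tauto)]

theorem reversed_color (hε : ∀ u w, Λ.Adj u w → ε u ≠ ε w) (u w : V) (h : Λ.Adj u w) :
    ε u + 1 ≠ ε w + 1 := fun h' => hε u w h (add_right_cancel h')

theorem twistQuiver_arrows_reverse (hε : ∀ u w, Λ.Adj u w → ε u ≠ ε w) (a b : V × Fin 2) :
    (twistQuiver Λ fun v => ε v + 1).arrows a b = (twistQuiver Λ ε).arrows b a := by
  rw [twistQuiver_arrows_in (reversed_color hε), twistQuiver_arrows_out hε]
  have : ∀ c i : Fin 2, sheetIn (c + 1) i = sheetOut c i := by decide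
  rw [this]

theorem compList_swap [DecidableEq V] (q : LabeledQuiver (V × Fin 2)) {l : List V} (hl : l.Nodup) :
    (∀ a b, (compList LabeledQuiver.swap l q).quiver.arrows a b =
      q.quiver.arrows (if a.1 ∈ l then flipSheet a else a) (if b.1 ∈ l then flipSheet b else b)) ∧
    ∀ a, (compList LabeledQuiver.swap l q).label a =
      q.label (if a.1 ∈ l then flipSheet a else a) := by
  induction l with
  | nil => simp [compList]
  | cons v l ih =>
    obtain ⟨hv, hl⟩ := List.nodup_cons.1 hl
    obtain ⟨ihq, ihl⟩ := ih hl
    have key : ∀ a : V × Fin 2, (if (Equiv.swap (v, (0 : Fin 2)) (v, 1) a).1 ∈ l then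
        flipSheet (Equiv.swap (v, (0 : Fin 2)) (v, 1) a) else Equiv.swap (v, (0 : Fin 2)) (v, 1) a) =
        if a.1 ∈ v :: l then flipSheet a else a := by
      intro a
      rw [swap_eq_flipSheet]
      by_cases ha : a.1 = v <;> simp [ha, hv]
    refine ⟨fun a b => ?_, fun a => ?_⟩
    · rw [← key, ← key]
      exact ihq _ _
    · rw [← key]
      exact ihl _

variable [Fintype V]

theorem mem_colorList {c : Fin 2} {v : V} : v ∈ colorList ε c ↔ ε v = c := by
  simp [colorList]

theorem exchangeSum_flip {K : Type*} [CommSemiring K] (F : V × Fin 2 → K) (v : V) :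
    exchangeSum Λ (fun a => F (flipSheet a)) v = exchangeSum Λ F v := by
  have h : (1 : Fin 2) + 1 = 0 := by decide
  simp [exchangeSum, flipSheet, h, add_comm]

variable [DecidableEq V]

theorem compList_mutate_twist (hε : ∀ u w, Λ.Adj u w → ε u ≠ ε w)
    {q : LabeledQuiver (V × Fin 2)} (hq : q.quiver = twistQuiver Λ ε) {l : List (V × Fin 2)}
    (hl : l.Nodup) (hflip : ∀ a ∈ l, flipSheet a ∈ l)
    (hind : ∀ a ∈ l, ∀ b ∈ l, ¬ Λ.Adj a.1 b.1) :
    (∀ u w, (compList LabeledQuiver.mutate l q).quiver.arrows u w =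
      if u ∈ l ∨ w ∈ l then (twistQuiver Λ ε).arrows w u else (twistQuiver Λ ε).arrows u w) ∧
    ∀ a, (compList LabeledQuiver.mutate l q).label a =
      if a ∈ l then exchangeSum Λ q.label a.1 / q.label a else q.label a := by
  obtain ⟨h1, h2⟩ := compList_mutate q hl fun a ha b hb => by
    rw [hq, twistQuiver_arrows_of_not_adj hε (hind a ha b hb)]
  rw [hq] at h1 h2
  refine ⟨fun u w => ?_, fun a => ?_⟩
  · have hs : ∑ v ∈ l.toFinset, (twistQuiver Λ ε).arrows u v * (twistQuiver Λ ε).arrows v w =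
        ∑ v ∈ l.toFinset, (twistQuiver Λ ε).arrows w v * (twistQuiver Λ ε).arrows v u := by
      refine sum_nbij' flipSheet flipSheet ?_ ?_ ?_ ?_ ?_
      · intro a ha
        simpa using hflip a (by simpa using ha)
      · intro a ha
        simpa using hflip a (by simpa using ha)
      · simp
      · simp
      · intro v _
        rw [twistQuiver_arrows_flipSheet hε u v, ← twistQuiver_arrows_flipSheet hε w (flipSheet v),
          flipSheet_flipSheet, mul_comm]
    rw [h1, hs]
    have := (twistQuiver Λ ε).no_two_cycle u w
    split_ifs <;> omega
  · rw [h2, prod_in_add_prod_out hε, exchangeSum]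
    split_ifs <;> rfl

/-- The operation on labels given by the mutations at all vertices of colour `c`. -/
noncomputable def colorStep (Λ : SimpleGraph V) (ε : V → Fin 2) (c : Fin 2)
    (L : V × Fin 2 → ℝ) (a : V × Fin 2) : ℝ :=
  if ε a.1 = c then exchangeSum Λ L a.1 / L a else L a

theorem colorMutate_twist {ε₁ : V → Fin 2} (hε : ∀ u w, Λ.Adj u w → ε u ≠ ε w)
    (hε₁ : ∀ u w, Λ.Adj u w → ε₁ u ≠ ε₁ w) {q : LabeledQuiver (V × Fin 2)}
    (hq : q.quiver = twistQuiver Λ ε₁) (c : Fin 2) :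
    (colorMutate (twistColor ε) c q).quiver = (twistQuiver Λ fun v => ε₁ v + 1) ∧
    (colorMutate (twistColor ε) c q).label = colorStep Λ ε c q.label := by
  have hmem : ∀ a : V × Fin 2, a ∈ colorList (twistColor ε) c ↔ ε a.1 = c :=
    fun a => mem_colorList
  obtain ⟨h1, h2⟩ := compList_mutate_twist hε₁ hq (l := colorList (twistColor ε) c)
    (nodup_toList _) (fun a ha => by rw [hmem] at ha ⊢; exact ha)
    (fun a ha b hb hab => hε _ _ hab (((hmem a).1 ha).trans ((hmem b).1 hb).symm))
  refine ⟨?_, ?_⟩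
  · ext u w
    rw [twistQuiver_arrows_reverse hε₁, colorMutate, h1]
    simp only [hmem]
    split_ifs with h
    · rfl
    · have hn : ¬ Λ.Adj u.1 w.1 := fun h' => by
        have := hε _ _ h'
        omega
      rw [twistQuiver_arrows_of_not_adj hε₁ hn,
        twistQuiver_arrows_of_not_adj hε₁ fun h' => hn h'.symm]
  · funext a
    rw [colorMutate, h2, colorStep]
    simp only [hmem]

theorem evolution_twist (hε : ∀ u w, Λ.Adj u w → ε u ≠ ε w) {q : LabeledQuiver (V × Fin 2)}
    (hq : q.quiver = twistQuiver Λ ε) (c : Fin 2) :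
    (evolution (twistColor ε) c q).quiver = twistQuiver Λ ε ∧
    (evolution (twistColor ε) c q).label =
      colorStep Λ ε (1 - c) (colorStep Λ ε c q.label) := by
  obtain ⟨h1, h2⟩ := colorMutate_twist hε hε hq c
  obtain ⟨h3, h4⟩ := colorMutate_twist hε (reversed_color hε) h1 (1 - c)
  have : ∀ i : Fin 2, i + 1 + 1 = i := by decide
  simp only [this] at h3
  exact ⟨h3, h4.trans (by rw [h2])⟩

theorem barMutate_twist (hε : ∀ u w, Λ.Adj u w → ε u ≠ ε w) {q : LabeledQuiver (V × Fin 2)}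
    (hq : q.quiver = twistQuiver Λ ε) (v : V) :
    (q.barMutate v).quiver = twistQuiver Λ ε ∧
    ∀ a, (q.barMutate v).label a =
      if a.1 = v then exchangeSum Λ q.label v / q.label (flipSheet a) else q.label a := by
  have hmem : ∀ a : V × Fin 2, a ∈ [(v, (0 : Fin 2)), (v, 1)] ↔ a.1 = v := by
    rintro ⟨u, i⟩
    rcases color_cases i with rfl | rfl <;> simp
  obtain ⟨h1, h2⟩ := compList_mutate_twist hε hq (l := [(v, (0 : Fin 2)), (v, 1)])
    (by simp) (fun a ha => by rw [hmem] at ha ⊢; exact ha)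
    (fun a ha b hb hab => by rw [(hmem a).1 ha, (hmem b).1 hb] at hab; exact Λ.irrefl hab)
  refine ⟨?_, fun a => ?_⟩
  · ext u w
    refine (h1 (Equiv.swap (v, 0) (v, 1) u) (Equiv.swap (v, 0) (v, 1) w)).trans ?_
    simp only [hmem, swap_eq_flipSheet]
    by_cases hu : u.1 = v
    · by_cases hw : w.1 = v
      · have hn : ¬ Λ.Adj u.1 w.1 := by rw [hu, hw]; exact Λ.irrefl
        simp only [hu, hw, if_true, flipSheet_fst, true_or]
        rw [twistQuiver_arrows_of_not_adj hε hn,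
          twistQuiver_arrows_of_not_adj hε (a := flipSheet w) (b := flipSheet u) fun h => hn h.symm]
      · simp only [hu, hw, if_true, if_false, flipSheet_fst, true_or]
        rw [← twistQuiver_arrows_flipSheet hε w, flipSheet_flipSheet]
    · by_cases hw : w.1 = v
      · simp only [hu, hw, if_true, if_false, flipSheet_fst, or_true]
        rw [twistQuiver_arrows_flipSheet hε]
      · simp [hu, hw]
  · refine (h2 (Equiv.swap (v, 0) (v, 1) a)).trans ?_
    simp only [hmem, swap_eq_flipSheet]
    by_cases h : a.1 = v <;> simp [h]

/-- The operation on labels given by the operators `μ̄_v` for `v` of colour `c`. -/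
noncomputable def barStep (Λ : SimpleGraph V) (ε : V → Fin 2) (c : Fin 2)
    (L : V × Fin 2 → ℝ) (a : V × Fin 2) : ℝ :=
  if ε a.1 = c then exchangeSum Λ L a.1 / L (flipSheet a) else L a

theorem compList_barMutate_twist (hε : ∀ u w, Λ.Adj u w → ε u ≠ ε w)
    {q : LabeledQuiver (V × Fin 2)} (hq : q.quiver = twistQuiver Λ ε) {l : List V} (hl : l.Nodup)
    (hind : ∀ u ∈ l, ∀ v ∈ l, ¬ Λ.Adj u v) :
    (compList LabeledQuiver.barMutate l q).quiver = twistQuiver Λ ε ∧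
    ∀ a, (compList LabeledQuiver.barMutate l q).label a =
      if a.1 ∈ l then exchangeSum Λ q.label a.1 / q.label (flipSheet a) else q.label a := by
  induction l with
  | nil => exact ⟨hq, fun a => by simp [compList]⟩
  | cons v l ih =>
    obtain ⟨hv, hl⟩ := List.nodup_cons.1 hl
    obtain ⟨ihq, ihl⟩ := ih hl fun a ha b hb =>
      hind a (List.mem_cons_of_mem _ ha) b (List.mem_cons_of_mem _ hb)
    obtain ⟨h1, h2⟩ := barMutate_twist hε ihq v
    refine ⟨h1, fun a => (h2 a).trans ?_⟩
    by_cases ha : a.1 = v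
    · rw [if_pos ha, if_pos (by simp [ha]), ihl, flipSheet_fst, ha, if_neg hv]
      congr 1
      refine exchangeSum_congr fun u i hu => ?_
      rw [ihl, if_neg fun h => hind u (List.mem_cons_of_mem _ h) v List.mem_cons_self hu]
    · rw [if_neg ha, ihl]
      simp [ha]

theorem barMutateAll_twist (hε : ∀ u w, Λ.Adj u w → ε u ≠ ε w) {q : LabeledQuiver (V × Fin 2)}
    (hq : q.quiver = twistQuiver Λ ε) (c : Fin 2) :
    (barMutateAll ε c q).quiver = twistQuiver Λ ε ∧
    (barMutateAll ε c q).label = barStep Λ ε (1 - c) (barStep Λ ε c q.label) := by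
  have hind : ∀ c, ∀ u ∈ colorList ε c, ∀ v ∈ colorList ε c, ¬ Λ.Adj u v := fun c u hu v hv h =>
    hε u v h ((mem_colorList.1 hu).trans (mem_colorList.1 hv).symm)
  obtain ⟨h1, h2⟩ := compList_barMutate_twist hε hq (l := colorList ε c) (nodup_toList _) (hind c)
  obtain ⟨h3, h4⟩ := compList_barMutate_twist hε h1 (l := colorList ε (1 - c))
    (nodup_toList _) (hind (1 - c))
  have h5 : (compList LabeledQuiver.barMutate (colorList ε c) q).label = barStep Λ ε c q.label := by
    funext a
    refine (h2 a).trans ?_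
    simp only [barStep, mem_colorList]
  refine ⟨h3, ?_⟩
  funext a
  refine (h4 a).trans ?_
  rw [h5]
  simp only [barStep, mem_colorList]

theorem swapAll_twist (hε : ∀ u w, Λ.Adj u w → ε u ≠ ε w) {q : LabeledQuiver (V × Fin 2)}
    (hq : q.quiver = twistQuiver Λ ε) :
    (swapAll V q).quiver = twistQuiver Λ ε ∧
    (swapAll V q).label = fun a => q.label (flipSheet a) := by
  obtain ⟨h1, h2⟩ := compList_swap q (nodup_toList (univ : Finset V))
  refine ⟨?_, ?_⟩
  · ext a b
    rw [swapAll, h1, hq]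
    simp only [mem_toList, mem_univ, if_true]
    rw [twistQuiver_arrows_flipSheet hε, twistQuiver_arrows_flipSheet hε]
  · funext a
    rw [swapAll, h2]
    simp

end Twist

section Action

variable {V : Type*} {Λ : SimpleGraph V} {ε : V → Fin 2}

theorem TwistLabeling.ext {q q' : TwistLabeling Λ ε} (h : ∀ a, q.1.label a = q'.1.label a) :
    q = q' :=
  Subtype.ext (LabeledQuiver.ext (q.2.trans q'.2.symm) (funext h))

variable [Fintype V]

/-- The factor by which `μ̄_v` multiplies the labels of `v₁` and `v₂`. -/
noncomputable def barFactor (Λ : SimpleGraph V) (L : V × Fin 2 → ℝ) (v : V) : ℝ :=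
  exchangeSum Λ L v / (L (v, 0) * L (v, 1))

theorem exchangeSum_pos {L : V × Fin 2 → ℝ} (hL : ∀ a, 0 < L a) (v : V) :
    0 < exchangeSum Λ L v :=
  add_pos (prod_pos fun _ _ => hL _) (prod_pos fun _ _ => hL _)

theorem barFactor_pos {L : V × Fin 2 → ℝ} (hL : ∀ a, 0 < L a) (v : V) : 0 < barFactor Λ L v :=
  div_pos (exchangeSum_pos hL v) (mul_pos (hL _) (hL _))

variable [DecidableEq V]

open Classical in
theorem barFactor_scale (L : V × Fin 2 → ℝ) (u v : V) (k : ℝ) :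
    barFactor Λ (fun a => (if a.1 = u then k else 1) * L a) v =
      (if v = u then (k ^ 2)⁻¹ else if Λ.Adj u v then k else 1) * barFactor Λ L v := by
  have h : ∏ w ∈ nbrs Λ v, (if w = u then k else 1) = if Λ.Adj u v then k else 1 := by
    rw [prod_ite_eq']
    simp
  have h2 : exchangeSum Λ (fun a => (if a.1 = u then k else 1) * L a) v =
      (if Λ.Adj u v then k else 1) * exchangeSum Λ L v := by
    simp only [exchangeSum, prod_mul_distrib, h, mul_add]
  rw [barFactor, h2, barFactor]
  by_cases hv : v = u
  · subst hv
    simp only [if_true, Λ.irrefl, if_false]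
    rw [one_mul, mul_mul_mul_comm, ← sq, inv_mul_eq_div, div_div, mul_comm (k ^ 2)]
  · simp only [hv, if_false, one_mul]
    rw [mul_div_assoc]

theorem barMutate_label (hε : ∀ u w, Λ.Adj u w → ε u ≠ ε w) {q : LabeledQuiver (V × Fin 2)}
    (hq : q.quiver = twistQuiver Λ ε) (v : V) :
    (q.barMutate v).label = fun a => (if a.1 = v then barFactor Λ q.label v else 1) * q.label a := by
  funext a
  rw [(barMutate_twist hε hq v).2]
  split_ifs with h
  · obtain ⟨u, i⟩ := a
    dsimp only at h
    subst h
    have h0 := q.label_pos (u, 0)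
    have h1 := q.label_pos (u, 1)
    have h11 : (1 : Fin 2) + 1 = 0 := by decide
    rcases color_cases i with rfl | rfl
    · simp only [flipSheet, zero_add, barFactor]
      field_simp
    · simp only [flipSheet, h11, barFactor]
      field_simp
  · rw [one_mul]

/-- The operator `μ̄_v` on the labelings of `Q_Λ`. -/
noncomputable def barMap (hε : ∀ u w, Λ.Adj u w → ε u ≠ ε w) (v : V) (q : TwistLabeling Λ ε) :
    TwistLabeling Λ ε :=
  ⟨q.1.barMutate v, (barMutate_twist hε q.2 v).1⟩

theorem barMap_label (hε : ∀ u w, Λ.Adj u w → ε u ≠ ε w) (v : V) (q : TwistLabeling Λ ε)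
    (a : V × Fin 2) : (barMap hε v q).1.label a =
      (if a.1 = v then barFactor Λ q.1.label v else 1) * q.1.label a :=
  congrFun (barMutate_label hε q.2 v) a

theorem barFactor_barMap_self (hε : ∀ u w, Λ.Adj u w → ε u ≠ ε w) (v : V)
    (q : TwistLabeling Λ ε) :
    barFactor Λ (barMap hε v q).1.label v = (barFactor Λ q.1.label v)⁻¹ := by
  have h := (barFactor_pos (Λ := Λ) q.1.label_pos v).ne'
  rw [funext (barMap_label hε v q), barFactor_scale, if_pos rfl]
  field_simp

theorem barFactor_barMap_of_adj (hε : ∀ u w, Λ.Adj u w → ε u ≠ ε w) {u v : V} (h : Λ.Adj u v)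
    (q : TwistLabeling Λ ε) :
    barFactor Λ (barMap hε u q).1.label v = barFactor Λ q.1.label u * barFactor Λ q.1.label v := by
  rw [funext (barMap_label hε u q), barFactor_scale, if_neg h.ne', if_pos h]

theorem barFactor_barMap_of_not_adj (hε : ∀ u w, Λ.Adj u w → ε u ≠ ε w) {u v : V} (huv : v ≠ u)
    (h : ¬ Λ.Adj u v) (q : TwistLabeling Λ ε) :
    barFactor Λ (barMap hε u q).1.label v = barFactor Λ q.1.label v := by
  rw [funext (barMap_label hε u q), barFactor_scale, if_neg huv, if_neg h, one_mul]

theorem barMap_involutive (hε : ∀ u w, Λ.Adj u w → ε u ≠ ε w) (v : V) :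
    Function.Involutive (barMap hε v) := by
  intro q
  refine TwistLabeling.ext fun a => ?_
  have := (barFactor_pos (Λ := Λ) q.1.label_pos v).ne'
  rw [barMap_label, barFactor_barMap_self, barMap_label]
  split_ifs
  · field_simp
  · ring

theorem barMap_comm (hε : ∀ u w, Λ.Adj u w → ε u ≠ ε w) {u v : V} (huv : u ≠ v)
    (h : ¬ Λ.Adj u v) (q : TwistLabeling Λ ε) :
    barMap hε u (barMap hε v q) = barMap hε v (barMap hε u q) := by
  refine TwistLabeling.ext fun a => ?_
  simp only [barMap_label, barFactor_barMap_of_not_adj hε huv fun h' => h h'.symm,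
    barFactor_barMap_of_not_adj hε huv.symm h]
  ring

theorem barMap_braid (hε : ∀ u w, Λ.Adj u w → ε u ≠ ε w) {u v : V} (h : Λ.Adj u v)
    (q : TwistLabeling Λ ε) :
    barMap hε u (barMap hε v (barMap hε u q)) = barMap hε v (barMap hε u (barMap hε v q)) := by
  have huv := h.ne
  have hu := (barFactor_pos (Λ := Λ) q.1.label_pos u).ne'
  have hv := (barFactor_pos (Λ := Λ) q.1.label_pos v).ne'
  refine TwistLabeling.ext fun a => ?_
  simp only [barMap_label, barFactor_barMap_of_adj hε h, barFactor_barMap_of_adj hε h.symm,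
    barFactor_barMap_self]
  by_cases h1 : a.1 = u
  · have h2 : a.1 ≠ v := fun h2 => huv (h1.symm.trans h2)
    simp only [h1, huv, if_true, if_false]
    field_simp
  · by_cases h2 : a.1 = v
    · simp only [h2, huv.symm, if_true, if_false]
      field_simp
    · simp only [h1, h2, if_false]

/-- The operator `μ̄_v` as a permutation of the labelings of `Q_Λ`. -/
noncomputable def barPerm (hε : ∀ u w, Λ.Adj u w → ε u ≠ ε w) (v : V) :
    Equiv.Perm (TwistLabeling Λ ε) :=
  (barMap_involutive hε v).toPerm

theorem barPerm_isLiftable (hε : ∀ u w, Λ.Adj u w → ε u ≠ ε w) :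
    (coxeterMatrix Λ).IsLiftable (barPerm hε) := by
  have hsq : ∀ v, barPerm hε v * barPerm hε v = 1 :=
    fun v => Equiv.ext fun q => barMap_involutive hε v q
  intro u v
  by_cases huv : u = v
  · subst huv
    rw [hsq, one_pow]
  · by_cases h : Λ.Adj u v
    · have hM : coxeterMatrix Λ u v = 3 := by simp [coxeterMatrix, huv, h]
      have hb : barPerm hε u * barPerm hε v * barPerm hε u =
          barPerm hε v * barPerm hε u * barPerm hε v :=
        Equiv.ext fun q => barMap_braid hε h q
      rw [hM]
      calc (barPerm hε u * barPerm hε v) ^ 3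
          = (barPerm hε u * barPerm hε v * barPerm hε u) *
            (barPerm hε v * barPerm hε u * barPerm hε v) := by
            simp only [pow_succ, pow_zero, one_mul, mul_assoc]
        _ = barPerm hε v * barPerm hε u * (barPerm hε v * barPerm hε v) *
            barPerm hε u * barPerm hε v := by rw [hb]; group
        _ = barPerm hε v * (barPerm hε u * barPerm hε u) * barPerm hε v := by
            rw [hsq, mul_one]; group
        _ = 1 := by rw [hsq, mul_one, hsq]
    · have hM : coxeterMatrix Λ u v = 2 := by simp [coxeterMatrix, huv, h]
      have hb : barPerm hε v * barPerm hε u = barPerm hε u * barPerm hε v :=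
        Equiv.ext fun q => (barMap_comm hε huv h q).symm
      rw [hM]
      calc (barPerm hε u * barPerm hε v) ^ 2
          = barPerm hε u * (barPerm hε v * barPerm hε u) * barPerm hε v := by
            simp only [pow_succ, pow_zero, one_mul, mul_assoc]
        _ = (barPerm hε u * barPerm hε u) * (barPerm hε v * barPerm hε v) := by rw [hb]; group
        _ = 1 := by rw [hsq, hsq, mul_one]

/-- The action of the Coxeter group of `Λ` on the labelings of `Q_Λ`. -/
noncomputable def coxeterAction (hε : ∀ u w, Λ.Adj u w → ε u ≠ ε w) :
    (coxeterMatrix Λ).Group →* Equiv.Perm (TwistLabeling Λ ε) :=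
  (coxeterMatrix Λ).toCoxeterSystem.lift ⟨barPerm hε, barPerm_isLiftable hε⟩

theorem coxeterAction_simple (hε : ∀ u w, Λ.Adj u w → ε u ≠ ε w) (v : V) :
    coxeterAction hε ((coxeterMatrix Λ).simple v) = barPerm hε v :=
  (coxeterMatrix Λ).toCoxeterSystem.lift_apply_simple (barPerm_isLiftable hε) v

theorem coxeterAction_list (hε : ∀ u w, Λ.Adj u w → ε u ≠ ε w) (l : List V)
    (q : TwistLabeling Λ ε) :
    (coxeterAction hε (l.map (coxeterMatrix Λ).simple).prod q).1 =
      compList LabeledQuiver.barMutate l q.1 := by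
  induction l with
  | nil => simp [compList]
  | cons v l ih =>
    rw [List.map_cons, List.prod_cons, map_mul, Equiv.Perm.mul_apply, coxeterAction_simple]
    change LabeledQuiver.barMutate v _ = LabeledQuiver.barMutate v _
    rw [ih]

theorem coxeterAction_coxeterElement (hε : ∀ u w, Λ.Adj u w → ε u ≠ ε w) (c : Fin 2)
    (q : TwistLabeling Λ ε) :
    (coxeterAction hε (coxeterElement Λ ε c) q).1 = barMutateAll ε c q.1 := by
  rw [coxeterElement, map_mul, Equiv.Perm.mul_apply, coxeterAction_list, coxeterAction_list]
  rfl

end Action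

section Dynamics

variable {V : Type*} [Fintype V] {Λ : SimpleGraph V} {ε : V → Fin 2}

theorem colorStep_eq_barStep (hε : ∀ u w, Λ.Adj u w → ε u ≠ ε w) (c : Fin 2)
    (L : V × Fin 2 → ℝ) :
    colorStep Λ ε (1 - c) (colorStep Λ ε c L) =
      fun a => barStep Λ ε (1 - c) (barStep Λ ε c L) (flipSheet a) := by
  funext a
  by_cases h : ε a.1 = c
  · have h' : ε a.1 ≠ 1 - c := by omega
    simp only [colorStep, barStep, flipSheet_fst, flipSheet_flipSheet, if_neg h', if_pos h]
  · have h' : ε a.1 = 1 - c := by omega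
    have he : exchangeSum Λ (colorStep Λ ε c L) a.1 = exchangeSum Λ (barStep Λ ε c L) a.1 := by
      rw [← exchangeSum_flip (barStep Λ ε c L)]
      refine exchangeSum_congr fun u i hu => ?_
      have hc : ε u = c := by
        have := hε _ _ hu
        omega
      simp only [colorStep, barStep, flipSheet_fst, flipSheet_flipSheet, if_pos hc]
    rw [colorStep, barStep, flipSheet_fst, if_pos h', if_pos h', he, flipSheet_flipSheet, colorStep,
      barStep, if_neg h, if_neg h]

theorem barStep_flip (c : Fin 2) (L : V × Fin 2 → ℝ) :
    barStep Λ ε c (fun a => L (flipSheet a)) = fun a => barStep Λ ε c L (flipSheet a) := by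
  funext a
  rw [barStep, barStep, exchangeSum_flip]
  rfl

theorem colorStep_eq_T {T : V × Fin 2 → ℤ → ℝ}
    (hT : ∀ a t, Even (t + 1 + ((ε a.1 : ℕ) : ℤ)) →
      T a (t + 1) * T a (t - 1) = exchangeSum Λ (fun b => T b t) a.1)
    (hε : ∀ u w, Λ.Adj u w → ε u ≠ ε w) {c : Fin 2} {L : V × Fin 2 → ℝ} (hL : ∀ a, 0 < L a)
    {t t' s : ℤ} (hs : Even (s + 1 + c.1))
    (ht : (t = s - 1 ∧ t' = s + 1) ∨ (t = s + 1 ∧ t' = s - 1))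
    (h1 : ∀ a, ε a.1 = c → L a = T a t) (h2 : ∀ a, ε a.1 ≠ c → L a = T a s)
    (a : V × Fin 2) : colorStep Λ ε c L a = if ε a.1 = c then T a t' else T a s := by
  rw [colorStep]
  split_ifs with h
  · have he : exchangeSum Λ L a.1 = exchangeSum Λ (fun b => T b s) a.1 :=
      exchangeSum_congr fun u i hu => h2 _ fun hc => hε _ _ hu (hc.trans h.symm)
    rw [he, ← hT a s (by rw [h]; exact hs), div_eq_iff (hL a).ne', h1 a h]
    rcases ht with ⟨rfl, rfl⟩ | ⟨rfl, rfl⟩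
    · rfl
    · rw [mul_comm]
  · exact h2 a h

variable [DecidableEq V]

/-- The time evolution on the labelings of `Q_Λ`. -/
noncomputable def evolutionMap (hε : ∀ u w, Λ.Adj u w → ε u ≠ ε w) (c : Fin 2)
    (q : TwistLabeling Λ ε) : TwistLabeling Λ ε :=
  ⟨evolution (twistColor ε) c q.1, (evolution_twist hε q.2 c).1⟩

/-- The operator `μ̄_Λ` on the labelings of `Q_Λ`. -/
noncomputable def barAllMap (hε : ∀ u w, Λ.Adj u w → ε u ≠ ε w) (c : Fin 2)
    (q : TwistLabeling Λ ε) : TwistLabeling Λ ε :=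
  ⟨barMutateAll ε c q.1, (barMutateAll_twist hε q.2 c).1⟩

/-- The vertex swap on the labelings of `Q_Λ`. -/
noncomputable def swapMap (hε : ∀ u w, Λ.Adj u w → ε u ≠ ε w)
    (q : TwistLabeling Λ ε) : TwistLabeling Λ ε :=
  ⟨swapAll V q.1, (swapAll_twist hε q.2).1⟩

theorem swapMap_involutive (hε : ∀ u w, Λ.Adj u w → ε u ≠ ε w) :
    Function.Involutive (swapMap hε) := fun q => TwistLabeling.ext fun a => by
  change (swapAll V (swapMap hε q).1).label a = _
  rw [(swapAll_twist hε (swapMap hε q).2).2]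
  change (swapAll V q.1).label _ = _
  rw [(swapAll_twist hε q.2).2]
  simp

theorem swapMap_iterate_label (hε : ∀ u w, Λ.Adj u w → ε u ≠ ε w) (n : ℕ)
    (q : TwistLabeling Λ ε) (v : V) (i : Fin 2) :
    ((swapMap hε)^[n] q).1.label (v, i) = q.1.label (v, turn n i) := by
  induction n generalizing i with
  | zero => rw [turn_of_even (by simp)]; rfl
  | succ n ih =>
    rw [Function.iterate_succ_apply']
    change (swapAll V ((swapMap hε)^[n] q).1).label (v, i) = _
    rw [(swapAll_twist hε ((swapMap hε)^[n] q).2).2]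
    change ((swapMap hε)^[n] q).1.label (v, i + 1) = _
    rw [ih, Nat.cast_succ, ← turn_turn]
    rfl

theorem evolutionMap_eq (hε : ∀ u w, Λ.Adj u w → ε u ≠ ε w) (c : Fin 2) (q : TwistLabeling Λ ε) :
    evolutionMap hε c q = swapMap hε (barAllMap hε c q) := TwistLabeling.ext fun a => by
  change (evolution (twistColor ε) c q.1).label a = (swapAll V (barAllMap hε c q).1).label a
  rw [(swapAll_twist hε (barAllMap hε c q).2).2, (evolution_twist hε q.2 c).2,
    colorStep_eq_barStep hε]
  change _ = (barMutateAll ε c q.1).label _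
  rw [(barMutateAll_twist hε q.2 c).2]

theorem swapMap_barAllMap (hε : ∀ u w, Λ.Adj u w → ε u ≠ ε w) (c : Fin 2) (q : TwistLabeling Λ ε) :
    swapMap hε (barAllMap hε c q) = barAllMap hε c (swapMap hε q) := TwistLabeling.ext fun a => by
  change (swapAll V (barAllMap hε c q).1).label a = (barMutateAll ε c (swapMap hε q).1).label a
  rw [(swapAll_twist hε (barAllMap hε c q).2).2, (barMutateAll_twist hε (swapMap hε q).2 c).2]
  change (barMutateAll ε c q.1).label _ = barStep Λ ε (1 - c) (barStep Λ ε c (swapAll V q.1).label) a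
  rw [(barMutateAll_twist hε q.2 c).2, (swapAll_twist hε q.2).2, barStep_flip, barStep_flip]

theorem evolution_iterate (hε : ∀ u w, Λ.Adj u w → ε u ≠ ε w) (c : Fin 2) (n : ℕ)
    (q : TwistLabeling Λ ε) :
    (evolution (twistColor ε) c)^[n] q.1 = ((evolutionMap hε c)^[n] q).1 :=
  ((Function.Semiconj.iterate_right (f := Subtype.val) (fun _ => rfl) n).eq q).symm

theorem barMutateAll_iterate (hε : ∀ u w, Λ.Adj u w → ε u ≠ ε w) (c : Fin 2) (n : ℕ)
    (q : TwistLabeling Λ ε) :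
    (barMutateAll ε c)^[n] q.1 = ((barAllMap hε c)^[n] q).1 :=
  ((Function.Semiconj.iterate_right (f := Subtype.val) (fun _ => rfl) n).eq q).symm

theorem evolution_label (hε : ∀ u w, Λ.Adj u w → ε u ≠ ε w) {q : TwistLabeling Λ ε}
    {T : V × Fin 2 → ℤ → ℝ} (hT : IsTSystem (twistQuiver Λ ε) (twistColor ε) q.1.label T) (k : ℕ)
    (a : V × Fin 2) :
    ((evolution (twistColor ε) 0)^[k] q.1).label a = T a (((ε a.1 : ℕ) : ℤ) + 2 * (k : ℤ)) ∧
    ((evolution (twistColor ε) 1)^[k] q.1).label a = T a (((ε a.1 : ℕ) : ℤ) - 2 * (k : ℤ)) := by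
  rw [isTSystem_twist_iff hε] at hT
  have h10 : ∀ c : Fin 2, c ≠ 0 → c = 1 := by decide
  have h01 : ∀ c : Fin 2, c ≠ 1 → c = 0 := by decide
  have hstep : ∀ (c : Fin 2) (k : ℕ), ((evolution (twistColor ε) c)^[k + 1] q.1).label =
      colorStep Λ ε (1 - c) (colorStep Λ ε c ((evolution (twistColor ε) c)^[k] q.1).label) ∧
      (∀ a, 0 < ((evolution (twistColor ε) c)^[k] q.1).label a) ∧
      ∀ a, 0 < colorStep Λ ε c ((evolution (twistColor ε) c)^[k] q.1).label a := by
    intro c k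
    rw [Function.iterate_succ_apply', evolution_iterate hε]
    have hq := ((evolutionMap hε c)^[k] q).2
    refine ⟨(evolution_twist hε hq c).2, LabeledQuiver.label_pos _, fun a => ?_⟩
    rw [← (colorMutate_twist hε hε hq c).2]
    exact LabeledQuiver.label_pos _ a
  constructor
  · induction k generalizing a with
    | zero => simpa using (hT.1 a).symm
    | succ k ih =>
      obtain ⟨h1, h2, h3⟩ := hstep 0 k
      have e1 := colorStep_eq_T hT.2 hε h2 (c := 0) (t := 2 * k) (t' := 2 * k + 2) (s := 2 * k + 1)
        ⟨k + 1, by simp; ring⟩ (Or.inl ⟨by ring, by ring⟩)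
        (fun a ha => by rw [ih, ha]; simp)
        (fun a ha => by rw [ih, h10 _ ha]; congr 1; simp; ring)
      have e2 := colorStep_eq_T hT.2 hε h3 (c := 1) (t := 2 * k + 1) (t' := 2 * k + 3)
        (s := 2 * k + 2) ⟨k + 2, by simp; ring⟩ (Or.inl ⟨by ring, by ring⟩)
        (fun a ha => by rw [e1, if_neg (by rw [ha]; decide)])
        (fun a ha => by rw [e1, if_pos (h01 _ ha)])
      rw [h1]
      refine (e2 a).trans ?_
      split_ifs with h
      · rw [h]; congr 1; push_cast; simp; ring
      · rw [h01 _ h]; congr 1; push_cast; simp; ring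
  · induction k generalizing a with
    | zero => simpa using (hT.1 a).symm
    | succ k ih =>
      obtain ⟨h1, h2, h3⟩ := hstep 1 k
      have e1 := colorStep_eq_T hT.2 hε h2 (c := 1) (t := -2 * k + 1) (t' := -2 * k - 1) (s := -2 * k)
        ⟨-k + 1, by simp; ring⟩ (Or.inr ⟨by ring, by ring⟩)
        (fun a ha => by rw [ih, ha]; congr 1; simp; ring)
        (fun a ha => by rw [ih, h01 _ ha]; congr 1; simp)
      have e2 := colorStep_eq_T hT.2 hε h3 (c := 0) (t := -2 * k) (t' := -2 * k - 2)
        (s := -2 * k - 1) ⟨-k, by simp; ring⟩ (Or.inr ⟨by ring, by ring⟩)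
        (fun a ha => by rw [e1, if_neg (by rw [ha]; decide)])
        (fun a ha => by rw [e1, if_pos (h10 _ ha)])
      rw [h1]
      refine (e2 a).trans ?_
      split_ifs with h
      · rw [h]; congr 1; push_cast; simp; ring
      · rw [h10 _ h]; congr 1; push_cast; simp; ring

variable {X : DynkinType}

theorem evolutionMap_iterate_coxeterNumber (e : Λ ≃g X.graph)
    (hε : ∀ u w, Λ.Adj u w → ε u ≠ ε w) (c : Fin 2) (q : TwistLabeling Λ ε) :
    (evolutionMap hε c)^[X.coxeterNumber] q = (swapMap hε)^[X.coxeterNumber] q := by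
  obtain ⟨T, hT, -, hper⟩ := exists_TSystem e hε (x := q.1.label)
    (fun a => (q.1.label_pos a).ne') (fun v => (exchangeSum_pos q.1.label_pos v).ne')
  refine TwistLabeling.ext ?_
  rintro ⟨v, i⟩
  rw [swapMap_iterate_label, ← evolution_iterate]
  have h0 := ((isTSystem_twist_iff hε).1 hT).1
  have hev : Even (((ε v : ℕ) : ℤ) + ((ε v : ℕ) : ℤ)) := ⟨_, rfl⟩
  rcases color_cases c with rfl | rfl
  · rw [(evolution_label hε hT _ (v, i)).1, ← h0]
    exact hper v i _ hev
  · rw [(evolution_label hε hT _ (v, i)).2, ← h0]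
    dsimp only
    have h := hper v (turn X.coxeterNumber i) ((ε v : ℕ) - 2 * X.coxeterNumber) (by grind)
    rw [sub_add_cancel, turn_turn, turn_of_even ⟨_, rfl⟩] at h
    exact h.symm

theorem barAllMap_iterate_coxeterNumber (e : Λ ≃g X.graph)
    (hε : ∀ u w, Λ.Adj u w → ε u ≠ ε w) (c : Fin 2) (q : TwistLabeling Λ ε) :
    (barAllMap hε c)^[X.coxeterNumber] q = q := by
  have h : evolutionMap hε c = swapMap hε ∘ barAllMap hε c := funext (evolutionMap_eq hε c)
  have hc : Function.Commute (swapMap hε) (barAllMap hε c) := swapMap_barAllMap hε c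
  have h1 := evolutionMap_iterate_coxeterNumber e hε c q
  rw [h, hc.comp_iterate] at h1
  exact (swapMap_involutive hε).injective.iterate _ h1

theorem evolutionMap_iterate_two_mul (e : Λ ≃g X.graph)
    (hε : ∀ u w, Λ.Adj u w → ε u ≠ ε w) (c : Fin 2) (q : TwistLabeling Λ ε) :
    (evolutionMap hε c)^[2 * X.coxeterNumber] q = q := by
  rw [two_mul, Function.iterate_add_apply, evolutionMap_iterate_coxeterNumber e hε,
    evolutionMap_iterate_coxeterNumber e hε, ← Function.iterate_add_apply, ← two_mul,
    (swapMap_involutive hε).iterate_two_mul, id]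

theorem evolutionMap_iterate_of_even (e : Λ ≃g X.graph)
    (hε : ∀ u w, Λ.Adj u w → ε u ≠ ε w) (hX : Even X.coxeterNumber) (c : Fin 2)
    (q : TwistLabeling Λ ε) : (evolutionMap hε c)^[X.coxeterNumber] q = q := by
  rw [evolutionMap_iterate_coxeterNumber e hε, (swapMap_involutive hε).iterate_even hX, id]

theorem exists_evolutionMap_iterate_ne (e : Λ ≃g X.graph)
    (hε : ∀ u w, Λ.Adj u w → ε u ≠ ε w) (hX : Odd X.coxeterNumber) (c : Fin 2) :
    ∃ q, (evolutionMap hε c)^[X.coxeterNumber] q ≠ q := by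
  have hr : 0 < X.rank := by
    cases X <;> simp only [DynkinType.rank] <;> omega
  obtain ⟨v⟩ : Nonempty V := ⟨e.symm ⟨0, hr⟩⟩
  let q : TwistLabeling Λ ε := ⟨⟨twistQuiver Λ ε, fun a => if a.2 = 0 then 1 else 2, fun a => by
    split_ifs <;> norm_num⟩, rfl⟩
  refine ⟨q, fun h => ?_⟩
  rw [evolutionMap_iterate_coxeterNumber e hε, (swapMap_involutive hε).iterate_odd hX] at h
  have h1 := congrFun (congrArg (fun q : TwistLabeling Λ ε => q.1.label) h) (v, 0)
  change (swapAll V q.1).label _ = _ at h1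
  rw [(swapAll_twist hε q.2).2] at h1
  simp [q, flipSheet] at h1

end Dynamics

end ZamPer

theorem mainTheorem2 {V : Type*} [Fintype V] [DecidableEq V] (Λ : SimpleGraph V)
    (X : DynkinType) (hΛ : Nonempty (Λ ≃g X.graph))
    (ε : V → Fin 2) (hε : ∀ u w, Λ.Adj u w → ε u ≠ ε w) :
    -- the birational `T`-system exists and is periodic, with period dividing `4h`
    ((∃ T, IsTSystem (twistQuiver Λ ε) (twistColor ε) RatFun.x T) ∧
      ∀ T, IsTSystem (twistQuiver Λ ε) (twistColor ε) RatFun.x T →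
        IsPeriodicWith (twistColor ε) T (2 * X.coxeterNumber)) ∧
    -- so does every tropical `T`-system
    (∀ l : V × Fin 2 → ℝ,
      (∃ τ, IsTropicalTSystem (twistQuiver Λ ε) (twistColor ε) l τ) ∧
      ∀ τ, IsTropicalTSystem (twistQuiver Λ ε) (twistColor ε) l τ →
        IsPeriodicWith (twistColor ε) τ (2 * X.coxeterNumber)) ∧
    -- the operators `evolution` are the time evolution of the `T`-system (forward and backward)
    (∀ q : TwistLabeling Λ ε,
      (∃ T, IsTSystem (twistQuiver Λ ε) (twistColor ε) q.1.label T) ∧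
      ∀ T, IsTSystem (twistQuiver Λ ε) (twistColor ε) q.1.label T → ∀ (k : ℕ) (a : V × Fin 2),
        ((evolution (twistColor ε) 0)^[k] q.1).label a
          = T a (((twistColor ε a : ℕ) : ℤ) + 2 * (k : ℤ)) ∧
        ((evolution (twistColor ε) 1)^[k] q.1).label a
          = T a (((twistColor ε a : ℕ) : ℤ) - 2 * (k : ℤ))) ∧
    -- the operators `μ̄_v` define an action `φ` of the Coxeter group of `Λ` on the labeled quivers
    -- `(Q_Λ, ρ)`, and the time evolution is the vertex swap times a Coxeter element
    (∃ φ : (coxeterMatrix Λ).Group →* Equiv.Perm (TwistLabeling Λ ε),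
      (∀ v q, (φ ((coxeterMatrix Λ).simple v) q).1 = q.1.barMutate v) ∧
      ∀ c : Fin 2,
        (∀ q, (φ (coxeterElement Λ ε c) q).1 = barMutateAll ε c q.1) ∧
        φ (coxeterElement Λ ε c) ^ X.coxeterNumber = 1 ∧
        ∀ q, evolution (twistColor ε) c q.1 = swapAll V (φ (coxeterElement Λ ε c) q).1) ∧
    -- the vertex swap commutes with the Coxeter element; the order of the time evolution
    -- divides `2h`, where the factor `2` is needed exactly if `h` is odd
    (∀ c : Fin 2,
      (∀ q : TwistLabeling Λ ε,
        evolution (twistColor ε) c q.1 = swapAll V (barMutateAll ε c q.1) ∧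
        swapAll V (barMutateAll ε c q.1) = barMutateAll ε c (swapAll V q.1) ∧
        (barMutateAll ε c)^[X.coxeterNumber] q.1 = q.1 ∧
        (evolution (twistColor ε) c)^[2 * X.coxeterNumber] q.1 = q.1) ∧
      (Even X.coxeterNumber → ∀ q : TwistLabeling Λ ε,
        (evolution (twistColor ε) c)^[X.coxeterNumber] q.1 = q.1) ∧
      (Odd X.coxeterNumber → ∃ q : TwistLabeling Λ ε,
        (evolution (twistColor ε) c)^[X.coxeterNumber] q.1 ≠ q.1)) := by
  obtain ⟨e⟩ := hΛ
  refine ⟨⟨?_, fun T hT => ?_⟩, fun l => ⟨?_, fun τ hτ => ?_⟩, fun q => ⟨?_, fun T hT k a => ?_⟩,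
    ⟨coxeterAction hε, fun v q => ?_, fun c => ⟨coxeterAction_coxeterElement hε c, ?_, fun q => ?_⟩⟩,
    fun c => ⟨fun q => ⟨?_, ?_, ?_, ?_⟩, fun hX q => ?_, fun hX => ?_⟩⟩
  · obtain ⟨T, hT, -⟩ := exists_TSystem e hε RatFun.x_ne_zero RatFun.exchangeSum_ne_zero
    exact ⟨T, hT⟩
  · obtain ⟨T', hT', h0, hper⟩ := exists_TSystem e hε RatFun.x_ne_zero RatFun.exchangeSum_ne_zero
    exact (isPeriodicWith_of_turn hper).congr (hT'.unique hε h0 hT)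
  · obtain ⟨τ, hτ, -⟩ := exists_tropicalTSystem e hε l
    exact ⟨τ, hτ⟩
  · obtain ⟨τ', hτ', hper⟩ := exists_tropicalTSystem e hε l
    exact (isPeriodicWith_of_turn hper).congr (hτ'.unique hε hτ)
  · obtain ⟨T, hT, -⟩ := exists_TSystem e hε (x := q.1.label)
      (fun a => (q.1.label_pos a).ne') (fun v => (exchangeSum_pos q.1.label_pos v).ne')
    exact ⟨T, hT⟩
  · exact evolution_label hε hT k a
  · rw [coxeterAction_simple]
    rfl
  · have h : ⇑(coxeterAction hε (coxeterElement Λ ε c)) = barAllMap hε c :=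
      funext fun q => Subtype.ext (coxeterAction_coxeterElement hε c q)
    refine Equiv.ext fun q => ?_
    rw [← Equiv.Perm.iterate_eq_pow, h, barAllMap_iterate_coxeterNumber e hε]
    rfl
  · rw [coxeterAction_coxeterElement]
    exact congrArg Subtype.val (evolutionMap_eq hε c q)
  · exact congrArg Subtype.val (evolutionMap_eq hε c q)
  · exact congrArg Subtype.val (swapMap_barAllMap hε c q)
  · rw [barMutateAll_iterate hε, barAllMap_iterate_coxeterNumber e hε]
  · rw [evolution_iterate hε, evolutionMap_iterate_two_mul e hε]
  · rw [evolution_iterate hε, evolutionMap_iterate_of_even e hε hX]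
  · obtain ⟨q, hq⟩ := exists_evolutionMap_iterate_ne e hε hX c
    exact ⟨q, fun h => hq (Subtype.ext (by rwa [evolution_iterate hε] at h))⟩
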